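/- Let $G_0,G_1,G_2,\dots$ be the Vignéras multiple gamma functions, i.e. functions holomorphic on $\mathbb C\setminus\mathbb Z_{\le 0}$, positive on $[1,\infty)$, with $G_0(z)=z$, $G_{n+1}(z+1)=G_n(z)\,G_{n+1}(z)$ for $z\in\mathbb C\setminus\mathbb Z_{\le 0}$, $G_n(1)=1$ and $\frac{d^{n+1}}{dx^{n+1}}\log G_n(x+1)\ge 0$ for real $x\ge 0$, for all $n\ge 0$. Such a sequence exists, and for $n\ge 1$ each $G_n(z+1)$ has a holomorphic logarithm $\log G_n(z+1)$ on $\mathbb C\setminus(-\infty,-1]$, normalized to be $0$ at $z=0$. Let $B_m(x)$ be the Bernoulli polynomials, $\frac{t e^{xt}}{e^t-1}=\sum_{m\ge 0}B_m(x)\frac{t^m}{m!}$, let $B_m=B_m(0)$, let $\zeta$ be the Riemann zeta function and $\log$ (of a complex number) the principal logarithm. For integers $j\ge 0$ put $$\varphi_{j,r}=\left(\frac{d}{dt}\right)^{r}\left\{\frac{t^{j+1}}{j+1}\log t-\frac{t^{j+1}}{(j+1)^2}\right\}\Bigg|_{t=1},\qquad P_j(x)=\sum_{r=0}^{j+1}\frac{B_r}{r!}\,\varphi_{j,r}\,x^{j+1-r},$$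 and define polynomials $G_{n,j}(z)$ for $n\ge 1$ by $\binom{z-u}{n-1}=\sum_{j=0}^{n-1}G_{n,j}(z)u^j$. Then for every $j\ge 0$ and every $z\in\mathbb C\setminus(-\infty,-1]$ the series in $$K_j(z)=\frac{B_{j+1}(z+1)}{j+1}\log(z+1)-\zeta'(-j)+P_j(z+1)+\sum_{k=1}^{\infty}\left[P_j(z+k+1)-P_j(z+k)+\frac{B_{j+1}(z+k+1)}{j+1}\log\left(\frac{z+k+1}{z+k}\right)\right]$$ converges absolutely, and for every integer $n\ge 1$ and every $z\in\mathbb C\setminus(-\infty,-1]$ $$\log G_n(z+1)=\sum_{j=0}^{n-1}G_{n,j}(z)K_j(z).$$ -/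

import Mathlib

/-- A *Vignéras hierarchy*: a sequence `G 0, G 1, G 2, …` of functions, each holomorphic away from
the non-positive integers, positive on `[1, ∞)`, satisfying the generalized Bohr-Mollerup
conditions. The values at the non-positive integers (where `G n` has zeros or poles) play no role,
and no condition is imposed there for `n ≥ 1`. -/
structure IsMultipleGammaHierarchy (G : ℕ → ℂ → ℂ) : Prop where
  differentiableOn : ∀ n, DifferentiableOn ℂ (G n) {z : ℂ | ∀ m : ℕ, z ≠ -(m : ℂ)}
  pos : ∀ n, ∀ x : ℝ, 0 ≤ x → ∃ r : ℝ, 0 < r ∧ G n ((x : ℂ) + 1) = (r : ℂ)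
  add_one : ∀ n, ∀ z : ℂ, (∀ m : ℕ, z ≠ -(m : ℂ)) → G (n + 1) (z + 1) = G n z * G (n + 1) z
  one : ∀ n, G n 1 = 1
  iteratedDeriv_nonneg : ∀ n, ∀ x : ℝ, 0 ≤ x →
    0 ≤ iteratedDeriv (n + 1) (fun t : ℝ => Real.log (G n ((t : ℂ) + 1)).re) x
  zero : ∀ z : ℂ, G 0 z = z

/-- `L` is the function `z ↦ log g (z + 1)`: the holomorphic branch of the logarithm on the plane
cut along `(-∞, -1]` (a star-shaped domain) that vanishes at `z = 0`. -/
structure IsLogBranch (g L : ℂ → ℂ) : Prop where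
  differentiableOn : DifferentiableOn ℂ L {z : ℂ | z + 1 ∈ Complex.slitPlane}
  exp_eq : ∀ z : ℂ, z + 1 ∈ Complex.slitPlane → Complex.exp (L z) = g (z + 1)
  zero : L 0 = 0

/-- `G_{n,j}(z)`, for `n ≥ 1`: the coefficient of `u ^ j` in the polynomial
`(z - u).choose (n - 1) = (z - u) (z - u - 1) ⋯ (z - u - n + 2) / (n - 1)!` in `u`. -/
noncomputable def binomCoeffPoly (n j : ℕ) (z : ℂ) : ℂ :=
  (Polynomial.C (((n - 1).factorial : ℂ)⁻¹) *
    (descPochhammer ℂ (n - 1)).comp (Polynomial.C z - Polynomial.X)).coeff j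

/-- The value `B_m(x)` of the Bernoulli polynomial. -/
noncomputable def bernoulliVal (m : ℕ) (x : ℂ) : ℂ :=
  Polynomial.aeval x (Polynomial.bernoulli m)

/-- `φ_{j,r}`: the `r`-th derivative of `t ^ (j+1) / (j+1) * log t - t ^ (j+1) / (j+1) ^ 2`
at `t = 1`. -/
noncomputable def phiCoeff (j r : ℕ) : ℝ :=
  iteratedDeriv r
    (fun t : ℝ => t ^ (j + 1) / ((j : ℝ) + 1) * Real.log t - t ^ (j + 1) / ((j : ℝ) + 1) ^ 2) 1

/-- The polynomial `P_j(x) = ∑_{r=0}^{j+1} B_r / r! * φ_{j,r} * x ^ (j+1-r)`, with `B_1 = -1/2`. -/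
noncomputable def polyP (j : ℕ) (x : ℂ) : ℂ :=
  ∑ r ∈ Finset.range (j + 2),
    ((bernoulli r : ℚ) : ℂ) / (r.factorial : ℂ) * (phiCoeff j r : ℂ) * x ^ (j + 1 - r)

/-- The `k`-th summand (`k ≥ 1`) of the series in `K_j(z)`. -/
noncomputable def kTerm (j : ℕ) (z : ℂ) (k : ℕ) : ℂ :=
  polyP j (z + k + 1) - polyP j (z + k) +
    bernoulliVal (j + 1) (z + k + 1) / ((j : ℂ) + 1) * Complex.log ((z + k + 1) / (z + k))

/-- The function `K_j(z)`; the series runs over the integers `k + 1 ≥ 1`. -/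
noncomputable def funK (j : ℕ) (z : ℂ) : ℂ :=
  bernoulliVal (j + 1) (z + 1) / ((j : ℂ) + 1) * Complex.log (z + 1)
    - deriv riemannZeta (-(j : ℂ)) + polyP j (z + 1) + ∑' k : ℕ, kTerm j z (k + 1)

/-! Write E_j(x) = B_{j+1}(x)/(j+1) · log x + P_j(x) (`powLogExpansion`). This is the truncated
Euler–Maclaurin expansion for summing x^j log x, and the k-th summand of K_j is its error on the
unit interval from z+k to z+k+1 (`kTerm_eq`). The truncation leaves an error O(k⁻²), whence absolute
convergence. The series telescopes, so K_j(z+1) = K_j(z) + (z+1)^j log(z+1) (`funK_add_one`). The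
same expansion for the sum of x^(-s), differentiated at s = -j, evaluates ζ'(-j) and gives K_j(0) =
0 (`funK_zero`).

Put L_0(z) = log(z+1) and L_n = ∑ G_{n,j} K_j for n ≥ 1 (`logMultipleGamma`). Pascal's rule for the
binomial coefficients gives L_{n+1}(z+1) = L_{n+1}(z) + L_n(z) and L_n(0) = 0. Moreover L_n is
O(|z|^(n+1/2)) on the right half-plane, so by Cauchy's estimates its derivatives of order above n
tend to 0 along the positive axis.

Uniqueness is a Bohr–Mollerup argument by induction on n. On the positive axis log G_n - L_n is
1-periodic, and its derivative of order n+1 is bounded below by a function tending to 0. Periodicity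
makes that derivative nonnegative, and Rolle's theorem with monotonicity then forces the difference
to be constant (`eq_zero_of_periodic_of_le_deriv`). The identity theorem gives G_n(z+1) = exp L_n(z)
on the cut plane. Existence uses the same L_n: exp L_n is continued to the left by the functional
equation, and the sign condition follows from the difference equation and the decay of derivatives.
-/

/-! ### A Taylor bound and the Euler–Maclaurin remainder -/

/-- The Taylor expansion at `0` of `F r`, where `F (r + 1)` is the derivative of `F r`. -/
theorem norm_sub_taylor_le {F : ℕ → ℝ → ℂ}
    (hF : ∀ r, ∀ t ∈ Set.Icc (0 : ℝ) 1, HasDerivAt (F r) (F (r + 1) t) t) {C : ℝ} (n : ℕ) :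
    ∀ r, (∀ t ∈ Set.Icc (0 : ℝ) 1, ‖F (r + n) t‖ ≤ C) → ∀ t ∈ Set.Icc (0 : ℝ) 1,
      ‖F r t - ∑ i ∈ Finset.range n, (t : ℂ) ^ i / (i.factorial : ℂ) * F (r + i) 0‖ ≤ C := by
  induction n with
  | zero => intro r h t ht; simpa using h t ht
  | succ n ih =>
    intro r h t ht
    have hC : 0 ≤ C := (norm_nonneg _).trans (h 0 (by simp))
    set g : ℝ → ℂ := fun t => F r t -
      ∑ i ∈ Finset.range (n + 1), (t : ℂ) ^ i / (i.factorial : ℂ) * F (r + i) 0 with hg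
    have hd : ∀ t ∈ Set.Icc (0 : ℝ) 1, HasDerivAt g (F (r + 1) t -
        ∑ i ∈ Finset.range n, (t : ℂ) ^ i / (i.factorial : ℂ) * F (r + 1 + i) 0) t := by
      intro t ht
      have h1 : HasDerivAt (fun t : ℝ => ∑ i ∈ Finset.range (n + 1),
          (t : ℂ) ^ i / (i.factorial : ℂ) * F (r + i) 0)
          (∑ i ∈ Finset.range (n + 1),
            ((i : ℂ) * (t : ℂ) ^ (i - 1)) / (i.factorial : ℂ) * F (r + i) 0) t := by
        apply HasDerivAt.fun_sum
        intro i _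
        have := ((hasDerivAt_id t).ofReal_comp).fun_pow i
        simpa using (this.div_const (i.factorial : ℂ)).mul_const (F (r + i) 0)
      refine ((hF r t ht).sub h1).congr_deriv ?_
      congr 1
      rw [Finset.sum_range_succ']
      simp only [Nat.cast_zero, zero_mul, zero_div, add_zero, Nat.add_sub_cancel]
      symm
      refine Finset.sum_congr rfl fun i _ => ?_
      have : ((i : ℂ) + 1) ≠ 0 := by exact_mod_cast Nat.succ_ne_zero i
      rw [Nat.factorial_succ, show r + 1 + i = r + (i + 1) by ring]
      push_cast
      rw [mul_div_mul_left _ _ this]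
    -- The derivative of a Taylor remainder is the remainder of one order less for `F (r + 1)`, so
    -- the induction hypothesis bounds it by `C`. As `t ≤ 1`, integration does not enlarge the
    -- constant.
    have hb := norm_image_sub_le_of_norm_deriv_le_segment' (f := g) (a := 0) (b := 1) (C := C)
      (fun t ht => (hd t ht).hasDerivWithinAt)
      (fun t ht => ih (r + 1) (fun s hs => by
        simpa [show r + 1 + n = r + (n + 1) by ring] using h s hs) t ⟨ht.1, ht.2.le⟩) t ht
    have h0 : g 0 = 0 := by
      simp [hg, Finset.sum_range_succ']
    rw [h0, sub_zero, sub_zero] at hb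
    exact hb.trans (by nlinarith [ht.2])

theorem sum_range_triangle {M : Type*} [AddCommMonoid M] (f : ℕ → ℕ → M) (n : ℕ) :
    ∑ r ∈ Finset.range n, ∑ i ∈ Finset.range (n - r), f r (r + i) =
      ∑ m ∈ Finset.range n, ∑ r ∈ Finset.range (m + 1), f r m := by
  rw [Finset.sum_sigma', Finset.sum_sigma']
  refine Finset.sum_bij' (fun p _ => ⟨p.1 + p.2, p.1⟩) (fun p _ => ⟨p.2, p.1 - p.2⟩) ?_ ?_ ?_ ?_ ?_
  · rintro ⟨a, b⟩ h; simp at h ⊢; omega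
  · rintro ⟨a, b⟩ h; simp at h ⊢; omega
  · rintro ⟨a, b⟩ h; simp
  · rintro ⟨a, b⟩ h; simp at h ⊢; omega
  · rintro ⟨a, b⟩ h; simp

/-- The Bernoulli recurrence divided by (m+1)!. It produces the cancellation in Euler–Maclaurin
summation. -/
theorem sum_bernoulli_div_factorial (m : ℕ) :
    ∑ r ∈ Finset.range (m + 1), ((bernoulli r : ℚ) : ℂ) / (r.factorial : ℂ) /
      ((m + 1 - r).factorial : ℂ) = if m = 0 then 1 else 0 := by
  have h := sum_bernoulli (m + 1)
  have h2 : ∀ r ∈ Finset.range (m + 1), ((bernoulli r : ℚ) : ℂ) / (r.factorial : ℂ) /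
      ((m + 1 - r).factorial : ℂ) =
      (((m + 1).choose r : ℚ) * bernoulli r : ℚ) / ((m + 1).factorial : ℂ) := by
    intro r hr
    have hr : r ≤ m + 1 := by simp at hr; omega
    have := Nat.choose_mul_factorial_mul_factorial hr
    have h3 : (((m + 1).choose r : ℂ)) * (r.factorial : ℂ) * ((m + 1 - r).factorial : ℂ)
      = ((m + 1).factorial : ℂ) := by exact_mod_cast this
    have h4 : (r.factorial : ℂ) ≠ 0 := by exact_mod_cast r.factorial_ne_zero
    have h5 : ((m + 1 - r).factorial : ℂ) ≠ 0 := by exact_mod_cast (m + 1 - r).factorial_ne_zero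
    have h6 : ((m + 1).factorial : ℂ) ≠ 0 := by exact_mod_cast (m + 1).factorial_ne_zero
    rw [div_div, div_eq_div_iff (mul_ne_zero h4 h5) h6, ← h3]
    push_cast
    ring
  rw [Finset.sum_congr rfl h2, ← Finset.sum_div, ← Rat.cast_sum, h]
  by_cases hm : m = 0 <;> simp [hm]

/-- The constant in the Euler–Maclaurin remainder estimate of order `M`. -/
noncomputable def eulerMaclaurinConst (M : ℕ) : ℝ :=
  ∑ r ∈ Finset.range (M + 1), ‖((bernoulli r : ℚ) : ℂ) / (r.factorial : ℂ)‖

theorem eulerMaclaurinConst_nonneg (M : ℕ) : 0 ≤ eulerMaclaurinConst M :=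
  Finset.sum_nonneg fun _ _ => norm_nonneg _

/-- Euler–Maclaurin summation on one unit interval. -/
theorem norm_eulerMaclaurin_le {F : ℕ → ℝ → ℂ}
    (hF : ∀ r, ∀ t ∈ Set.Icc (0 : ℝ) 1, HasDerivAt (F r) (F (r + 1) t) t) {C : ℝ} (M : ℕ)
    (hC : ∀ t ∈ Set.Icc (0 : ℝ) 1, ‖F (M + 2) t‖ ≤ C) :
    ‖F 1 0 - ∑ r ∈ Finset.range (M + 1), ((bernoulli r : ℚ) : ℂ) / (r.factorial : ℂ) *
      (F r 1 - F r 0)‖ ≤ eulerMaclaurinConst M * C := by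
  -- Taylor-expand each `F r 1 - F r 0` at 0 and group by total order m = r + i: the coefficient of
  -- `F (m + 1) 0` is the Bernoulli sum above, so only m = 0 survives.
  have key : F 1 0 = ∑ r ∈ Finset.range (M + 1), ((bernoulli r : ℚ) : ℂ) / (r.factorial : ℂ) *
      ∑ i ∈ Finset.range (M + 1 - r), F (r + i + 1) 0 / ((i + 1).factorial : ℂ) := by
    have h1 := sum_range_triangle (fun r m => ((bernoulli r : ℚ) : ℂ) / (r.factorial : ℂ) /
      ((m + 1 - r).factorial : ℂ) * F (m + 1) 0) (M + 1)
    simp_rw [← Finset.sum_mul, sum_bernoulli_div_factorial] at h1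
    simp only [ite_mul, one_mul, zero_mul, Finset.sum_ite_eq', Finset.mem_range,
      Nat.zero_lt_succ, if_true, zero_add] at h1
    rw [← h1]
    refine Finset.sum_congr rfl fun r _ => ?_
    rw [Finset.mul_sum]
    refine Finset.sum_congr rfl fun i _ => ?_
    rw [show r + i + 1 - r = i + 1 by omega]
    ring
  rw [key, ← Finset.sum_sub_distrib, eulerMaclaurinConst, Finset.sum_mul]
  refine norm_sum_le_of_le _ fun r hr => ?_
  rw [← mul_sub, norm_mul]
  refine mul_le_mul_of_nonneg_left ?_ (norm_nonneg _)
  have hr : r ≤ M := by simp at hr; omega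
  -- The Taylor order depends on `r` so that every remainder is controlled by the same derivative `F
  -- (M + 2)`.
  have := norm_sub_taylor_le hF (M + 1 - r + 1) r (C := C)
    (by rwa [show r + (M + 1 - r + 1) = M + 2 by omega]) 1 (by simp)
  rw [Finset.sum_range_succ'] at this
  rw [norm_sub_rev]
  refine (congrArg norm ?_).trans_le this
  simp only [Complex.ofReal_one, one_pow, add_zero, Nat.factorial_zero, Nat.cast_one, div_one,
    one_mul]
  simp_rw [← add_assoc, one_div, div_eq_inv_mul]
  ring

/-! ### The derivatives of `x ^ (j + 1) * log x / (j + 1) - x ^ (j + 1) / (j + 1) ^ 2` -/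

/-- The coefficient of `x ^ (j + 1 - r) * log x` in the `r`-th derivative. -/
noncomputable def powLogCoeff (j : ℕ) : ℕ → ℝ
  | 0 => 1 / ((j : ℝ) + 1)
  | r + 1 => powLogCoeff j r * ((j : ℝ) + 1 - r)

/-- The coefficient of `x ^ (j + 1 - r)` in the `r`-th derivative. -/
noncomputable def powLogConst (j : ℕ) : ℕ → ℝ
  | 0 => -1 / ((j : ℝ) + 1) ^ 2
  | r + 1 => powLogConst j r * ((j : ℝ) + 1 - r) + powLogCoeff j r

/-- The `r`-th derivative of `x ^ (j + 1) * log x / (j + 1) - x ^ (j + 1) / (j + 1) ^ 2`. -/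
noncomputable def powLogDeriv (j r : ℕ) (x : ℂ) : ℂ :=
  x ^ ((j : ℤ) + 1 - r) * (powLogCoeff j r * Complex.log x + powLogConst j r)

/-- The recurrence factor j + 1 - r vanishes at r = j + 1, so later derivatives contain no
logarithm. -/
theorem powLogCoeff_eq_zero (j r : ℕ) : powLogCoeff j (j + 2 + r) = 0 := by
  induction r with
  | zero => simp [powLogCoeff]
  | succ r ih => rw [← add_assoc, powLogCoeff, ih, zero_mul]

theorem powLogCoeff_eq (j r : ℕ) (hr : r ≤ j + 1) :
    powLogCoeff j r / (r.factorial : ℝ) = ((j + 1).choose r : ℝ) / ((j : ℝ) + 1) := by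
  induction r with
  | zero => simp [powLogCoeff]
  | succ r ih =>
    have h := Nat.choose_succ_right_eq (j + 1) r
    have h' : ((j + 1).choose (r + 1) : ℝ) * (r + 1) = ((j + 1).choose r : ℝ) * (j + 1 - r) := by
      rw [show ((j : ℝ) + 1 - r) = ((j + 1 - r : ℕ) : ℝ) by
        rw [Nat.cast_sub (by omega)]; push_cast; ring]
      exact_mod_cast h
    have ih := ih (by omega)
    have hf : (r.factorial : ℝ) ≠ 0 := by exact_mod_cast r.factorial_ne_zero
    have hr1 : (r : ℝ) + 1 ≠ 0 := by positivity
    have hj1 : (j : ℝ) + 1 ≠ 0 := by positivity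
    rw [powLogCoeff, Nat.factorial_succ]
    push_cast
    field_simp at ih ⊢
    linear_combination (j + 1 - (r : ℝ)) * ih - (r.factorial : ℝ) * h'

theorem hasDerivAt_powLogDeriv (j r : ℕ) {x : ℂ} (hx : x ∈ Complex.slitPlane) :
    HasDerivAt (powLogDeriv j r) (powLogDeriv j (r + 1) x) x := by
  have hx0 := Complex.slitPlane_ne_zero hx
  have h := (hasDerivAt_zpow ((j : ℤ) + 1 - r) x (Or.inl hx0)).fun_mul
    (((Complex.hasDerivAt_log hx).const_mul (powLogCoeff j r : ℂ)).add_const (powLogConst j r : ℂ))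
  refine h.congr_deriv ?_
  rw [powLogDeriv, show (j : ℤ) + 1 - (r + 1 : ℕ) = (j : ℤ) + 1 - r - 1 by push_cast; ring,
    powLogCoeff, powLogConst]
  have : x ^ ((j : ℤ) + 1 - r) = x ^ ((j : ℤ) + 1 - r - 1) * x := by
    rw [← zpow_add_one₀ hx0]; ring_nf
  rw [this]
  push_cast
  field_simp
  ring

/-- The subtracted term x^(j+1)/(j+1)² is chosen so that the part without logarithm cancels here. -/
theorem powLogDeriv_one (j : ℕ) (x : ℂ) : powLogDeriv j 1 x = x ^ j * Complex.log x := by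
  have hj : (j : ℂ) + 1 ≠ 0 := by exact_mod_cast Nat.succ_ne_zero j
  have h1 : powLogCoeff j 1 = 1 := by
    have : (j : ℝ) + 1 ≠ 0 := by positivity
    simp [powLogCoeff, this]
  have h2 : powLogConst j 1 = 0 := by
    have : (j : ℝ) + 1 ≠ 0 := by positivity
    simp only [powLogConst, powLogCoeff]; field_simp; simp
  simp [powLogDeriv, h1, h2]

/-- At t = 1 the logarithm vanishes and every power of t is 1, so only the constant of the closed
form remains. -/
theorem phiCoeff_eq (j r : ℕ) : phiCoeff j r = powLogConst j r := by
  have key : ∀ r : ℕ, ∀ t : ℝ, 0 < t → iteratedDeriv r (fun t : ℝ =>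
      t ^ (j + 1) / ((j : ℝ) + 1) * Real.log t - t ^ (j + 1) / ((j : ℝ) + 1) ^ 2) t =
      (powLogDeriv j r t).re := by
    intro r
    induction r with
    | zero =>
      intro t ht
      have : powLogDeriv j 0 t = ((t ^ (j + 1) / ((j : ℝ) + 1) * Real.log t -
          t ^ (j + 1) / ((j : ℝ) + 1) ^ 2 : ℝ) : ℂ) := by
        rw [powLogDeriv, powLogCoeff, powLogConst, ← Complex.ofReal_log ht.le,
          show (j : ℤ) + 1 - (0 : ℕ) = ((j + 1 : ℕ) : ℤ) by push_cast; ring, zpow_natCast]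
        push_cast
        ring
      rw [this, Complex.ofReal_re, iteratedDeriv_zero]
    | succ r ih =>
      intro t ht
      rw [iteratedDeriv_succ]
      have h1 : HasDerivAt (fun t : ℝ => (powLogDeriv j r t).re) (powLogDeriv j (r + 1) t).re t :=
        (hasDerivAt_powLogDeriv j r (Or.inl (by simpa using ht))).real_of_complex
      rw [← h1.deriv]
      apply Filter.EventuallyEq.deriv_eq
      filter_upwards [lt_mem_nhds ht] with s hs using ih s hs
  rw [phiCoeff, key r 1 one_pos]
  simp [powLogDeriv]

/-- The Euler–Maclaurin expansion `B_{j+1}(x) / (j + 1) * log x + P_j(x)`. -/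
noncomputable def powLogExpansion (j : ℕ) (x : ℂ) : ℂ :=
  ∑ r ∈ Finset.range (j + 2), ((bernoulli r : ℚ) : ℂ) / (r.factorial : ℂ) * powLogDeriv j r x

theorem bernoulliVal_eq_sum (j : ℕ) (x : ℂ) : bernoulliVal (j + 1) x / ((j : ℂ) + 1) =
    ∑ r ∈ Finset.range (j + 2), ((bernoulli r : ℚ) : ℂ) / (r.factorial : ℂ) *
      powLogCoeff j r * x ^ (j + 1 - r) := by
  rw [bernoulliVal, Polynomial.bernoulli, map_sum, Finset.sum_div]
  refine Finset.sum_congr rfl fun r hr => ?_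
  have h := congrArg (fun y : ℝ => (y : ℂ)) (powLogCoeff_eq j r (by simp at hr; omega))
  simp only [Polynomial.aeval_monomial, eq_ratCast]
  push_cast at h ⊢
  linear_combination (-((bernoulli r : ℚ) : ℂ) * x ^ (j + 1 - r)) * h

theorem powLogExpansion_eq (j : ℕ) (x : ℂ) : powLogExpansion j x =
    bernoulliVal (j + 1) x / ((j : ℂ) + 1) * Complex.log x + polyP j x := by
  rw [bernoulliVal_eq_sum, polyP, powLogExpansion, Finset.sum_mul, ← Finset.sum_add_distrib]
  refine Finset.sum_congr rfl fun r hr => ?_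
  have hr : r ≤ j + 1 := by simp at hr; omega
  rw [phiCoeff_eq, powLogDeriv, show (j : ℤ) + 1 - r = ((j + 1 - r : ℕ) : ℤ) by
    rw [Nat.cast_sub hr]; push_cast; ring, zpow_natCast]
  ring

theorem Complex.add_one_mem_slitPlane {x : ℂ} (hx : x ∈ Complex.slitPlane) :
    x + 1 ∈ Complex.slitPlane := by
  rcases hx with h | h
  · left; simp; linarith
  · right; simpa using h

theorem Complex.add_natCast_mem_slitPlane {x : ℂ} (hx : x ∈ Complex.slitPlane) (n : ℕ) :
    x + n ∈ Complex.slitPlane := by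
  rcases hx with h | h
  · left; simp; linarith [n.cast_nonneg (α := ℝ)]
  · right; simpa using h

/-- Adding 1 preserves the imaginary part, so both arguments lie in [0, π] or both in (-π, 0), with
arg x ≠ π. Their difference stays in the principal range. -/
theorem Complex.log_add_one_div {x : ℂ} (hx : x ∈ Complex.slitPlane) :
    Complex.log ((x + 1) / x) = Complex.log (x + 1) - Complex.log x := by
  have hx1 := Complex.add_one_mem_slitPlane hx
  have h0 := Complex.slitPlane_ne_zero hx
  have h1 := Complex.slitPlane_ne_zero hx1
  have ha : x.arg ≠ Real.pi := Complex.slitPlane_arg_ne_pi hx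
  rw [div_eq_mul_inv, Complex.log_mul h1 (inv_ne_zero h0), Complex.log_inv _ ha, sub_eq_add_neg]
  rw [Complex.arg_inv, if_neg ha]
  have a1 := Complex.arg_le_pi (x + 1)
  have a2 := Complex.neg_pi_lt_arg (x + 1)
  have a3 := Complex.neg_pi_lt_arg x
  have a4 := lt_of_le_of_ne (Complex.arg_le_pi x) ha
  rcases le_or_gt 0 x.im with him | him
  · have b1 := Complex.arg_nonneg_iff.2 him
    have b2 : 0 ≤ (x + 1).arg := Complex.arg_nonneg_iff.2 (by simpa using him)
    constructor <;> linarith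
  · have b1 := Complex.arg_neg_iff.2 him
    have b2 : (x + 1).arg < 0 := Complex.arg_neg_iff.2 (by simpa using him)
    constructor <;> linarith

theorem bernoulliVal_add_one (j : ℕ) (x : ℂ) :
    bernoulliVal (j + 1) (x + 1) / ((j : ℂ) + 1) =
      bernoulliVal (j + 1) x / ((j : ℂ) + 1) + x ^ j := by
  have h := congrArg (Polynomial.aeval x) (Polynomial.bernoulli_comp_one_add_X (j + 1))
  have hj : (j : ℂ) + 1 ≠ 0 := by exact_mod_cast Nat.succ_ne_zero j
  simp [Polynomial.aeval_comp] at h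
  rw [bernoulliVal, bernoulliVal, add_comm x 1, h]
  field_simp

/-- The relation B_{j+1}(x+1) - B_{j+1}(x) = (j+1) x^j turns the factor B_{j+1}(x+1) in front of log
x into B_{j+1}(x), at the cost of the summand x^j log x. -/
theorem kTerm_eq (j : ℕ) (z : ℂ) (k : ℕ) (h : z + k ∈ Complex.slitPlane) :
    kTerm j z k = powLogExpansion j (z + k + 1) - powLogExpansion j (z + k) -
      powLogDeriv j 1 (z + k) := by
  rw [kTerm, powLogExpansion_eq, powLogExpansion_eq, Complex.log_add_one_div h,
    bernoulliVal_add_one, powLogDeriv_one]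
  ring

/-- The summands of the series for `K_j` decay quadratically. -/
theorem norm_kTerm_le (j : ℕ) (z : ℂ) (k : ℕ) (h : 0 < (z + k).re) :
    ‖kTerm j z k‖ ≤ eulerMaclaurinConst (j + 1) * (|powLogConst j (j + 3)| / (z + k).re ^ 2) := by
  set x := z + k with hx
  have hmem : ∀ t ∈ Set.Icc (0 : ℝ) 1, x + t ∈ Complex.slitPlane := fun t ht => by
    left; simp; linarith [ht.1]
  have := norm_eulerMaclaurin_le (F := fun r t => powLogDeriv j r (x + t))
    (C := |powLogConst j (j + 3)| / x.re ^ 2) (fun r t ht => by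
      have := (hasDerivAt_powLogDeriv j r (hmem t ht)).scomp t
        ((hasDerivAt_id t).ofReal_comp.const_add x)
      simpa [Function.comp_def] using this) (j + 1) (fun t ht => by
      -- At order j + 3 only a constant multiple of x⁻² is left.
      have hα : powLogCoeff j (j + 3) = 0 := powLogCoeff_eq_zero j 1
      simp only [powLogDeriv, show j + 1 + 2 = j + 3 by ring, hα]
      rw [show (j : ℤ) + 1 - (j + 3 : ℕ) = -2 by push_cast; ring, Complex.ofReal_zero, zero_mul,
        zero_add, norm_mul, Complex.norm_real, Real.norm_eq_abs, zpow_neg, norm_inv,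
        inv_mul_eq_div]
      have h1 : x.re ≤ ‖x + t‖ := by
        refine le_trans ?_ (Complex.re_le_norm _)
        simp [ht.1]
      have h2 : ‖(x + t) ^ (2 : ℤ)‖ = ‖x + t‖ ^ 2 := by
        rw [norm_zpow]; norm_cast
      rw [h2]
      gcongr)
  rw [kTerm_eq j z k (Or.inl h), ← hx, ← norm_neg]
  refine (congrArg norm ?_).trans_le this
  simp only [powLogExpansion, Complex.ofReal_zero, add_zero, Complex.ofReal_one, mul_sub,
    Finset.sum_sub_distrib]
  ring

/-! ### The functions `K_j` -/

theorem kTerm_shift (j : ℕ) (z : ℂ) (N k : ℕ) : kTerm j (z + N) k = kTerm j z (k + N) := by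
  simp only [kTerm]
  rw [show z + N + k = z + (k + N : ℕ) by push_cast; ring]

/-- Uniformity over the right half-plane serves both holomorphy of the sum and its boundedness
there. -/
theorem exists_summable_bound_kTerm (j : ℕ) : ∃ u : ℕ → ℝ, Summable u ∧
    ∀ z : ℂ, 0 ≤ z.re → ∀ k, ‖kTerm j z (k + 1)‖ ≤ u k := by
  refine ⟨fun k => eulerMaclaurinConst (j + 1) * (|powLogConst j (j + 3)| / ((k : ℝ) + 1) ^ 2),
    ?_, ?_⟩
  · simp_rw [div_eq_mul_inv]
    refine ((Summable.mul_left _ ?_)).mul_left _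
    have := (summable_nat_add_iff 1).2 (Real.summable_nat_pow_inv.2 one_lt_two)
    simpa using this
  · intro z hz k
    have h1 : (z + (k + 1 : ℕ)).re = z.re + (k + 1) := by simp
    have hk : (0 : ℝ) ≤ k := k.cast_nonneg
    refine (norm_kTerm_le j z (k + 1) (by rw [h1]; linarith)).trans ?_
    rw [h1]
    refine mul_le_mul_of_nonneg_left ?_ (eulerMaclaurinConst_nonneg _)
    exact div_le_div_of_nonneg_left (abs_nonneg _) (by positivity)
      (pow_le_pow_left₀ (by positivity) (by linarith) 2)

theorem exists_nat_re_add_pos (z : ℂ) : ∃ N : ℕ, 0 < (z + N).re := by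
  obtain ⟨N, hN⟩ := exists_nat_gt (-z.re)
  exact ⟨N, by simp; linarith⟩

theorem summable_norm_kTerm (j : ℕ) (z : ℂ) : Summable fun k : ℕ => ‖kTerm j z (k + 1)‖ := by
  obtain ⟨N, hN⟩ := exists_nat_re_add_pos z
  obtain ⟨u, hu, hb⟩ := exists_summable_bound_kTerm j
  rw [← summable_nat_add_iff N]
  refine Summable.of_nonneg_of_le (fun _ => norm_nonneg _) (fun k => ?_) hu
  have := hb (z + N) hN.le k
  rwa [kTerm_shift, show k + 1 + N = k + N + 1 by ring] at this

theorem funK_eq (j : ℕ) (z : ℂ) : funK j z = powLogExpansion j (z + 1) -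
    deriv riemannZeta (-(j : ℂ)) + ∑' k : ℕ, kTerm j z (k + 1) := by
  rw [funK, powLogExpansion_eq]
  ring

/-- Shifting z drops the first term of the series; that term is exactly the change in the expansion
minus the new summand. -/
theorem funK_add_one (j : ℕ) {z : ℂ} (hz : z + 1 ∈ Complex.slitPlane) :
    funK j (z + 1) = funK j z + (z + 1) ^ j * Complex.log (z + 1) := by
  have h1 : ∑' k : ℕ, kTerm j z (k + 1) = kTerm j z 1 + ∑' k : ℕ, kTerm j (z + 1) (k + 1) := by
    rw [(summable_norm_kTerm j z).of_norm.tsum_eq_zero_add]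
    congr 1
    refine tsum_congr fun k => ?_
    simpa using (kTerm_shift j z 1 (k + 1)).symm
  rw [funK_eq, funK_eq, h1, kTerm_eq j z 1 (by simpa using hz), ← powLogDeriv_one]
  push_cast
  ring

theorem funK_add_natCast (j : ℕ) {z : ℂ} (hz : z + 1 ∈ Complex.slitPlane) (N : ℕ) :
    funK j (z + N) = funK j z +
      ∑ i ∈ Finset.range N, (z + i + 1) ^ j * Complex.log (z + i + 1) := by
  induction N with
  | zero => simp
  | succ N ih =>
    have h : z + N + 1 ∈ Complex.slitPlane := by
      rw [add_right_comm]; exact Complex.add_natCast_mem_slitPlane hz N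
    rw [Nat.cast_succ, ← add_assoc, funK_add_one j h, ih, Finset.sum_range_succ]
    ring

theorem isOpen_slitPlane_sub_one : IsOpen {z : ℂ | z + 1 ∈ Complex.slitPlane} :=
  Complex.isOpen_slitPlane.preimage (continuous_id.add continuous_const)

theorem differentiableAt_powLogExpansion (j : ℕ) {x : ℂ} (hx : x ∈ Complex.slitPlane) :
    DifferentiableAt ℂ (powLogExpansion j) x :=
  DifferentiableAt.fun_sum fun r _ =>
    (hasDerivAt_powLogDeriv j r hx).differentiableAt.const_mul _

theorem differentiableAt_kTerm (j k : ℕ) {z : ℂ} (hz : z + k ∈ Complex.slitPlane) :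
    DifferentiableAt ℂ (fun z => kTerm j z k) z := by
  have h1 : (fun z => kTerm j z k) =ᶠ[nhds z] fun z => powLogExpansion j (z + k + 1) -
      powLogExpansion j (z + k) - powLogDeriv j 1 (z + k) := by
    have ho : IsOpen {z : ℂ | z + k ∈ Complex.slitPlane} :=
      Complex.isOpen_slitPlane.preimage (continuous_id.add continuous_const)
    filter_upwards [ho.mem_nhds hz] with w hw using kTerm_eq j w k hw
  refine DifferentiableAt.congr_of_eventuallyEq ?_ h1
  have e1 : DifferentiableAt ℂ (fun z : ℂ => z + k) z := by fun_prop
  have e2 : DifferentiableAt ℂ (fun z : ℂ => z + k + 1) z := by fun_prop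
  exact ((DifferentiableAt.comp (g := powLogExpansion j) z (differentiableAt_powLogExpansion j
    (Complex.add_one_mem_slitPlane hz)) e2).sub (DifferentiableAt.comp (g := powLogExpansion j) z
    (differentiableAt_powLogExpansion j hz) e1)).sub (DifferentiableAt.comp
    (g := powLogDeriv j 1) z (hasDerivAt_powLogDeriv j 1 hz).differentiableAt e1)

theorem differentiableAt_funK_of_re_pos (j : ℕ) {z : ℂ} (hz : 0 < z.re) :
    DifferentiableAt ℂ (funK j) z := by
  obtain ⟨u, hu, hb⟩ := exists_summable_bound_kTerm j
  have ho : IsOpen {w : ℂ | 0 < w.re} := isOpen_lt continuous_const Complex.continuous_re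
  have h := Complex.differentiableOn_tsum_of_summable_norm hu (F := fun k z => kTerm j z (k + 1))
    (fun k w (hw : 0 < w.re) => (differentiableAt_kTerm j (k + 1) (Or.inl (by
      simp; positivity))).differentiableWithinAt) ho
    (fun k w (hw : 0 < w.re) => hb w hw.le k)
  have h1 := (h z hz).differentiableAt (ho.mem_nhds hz)
  have h2 : DifferentiableAt ℂ (fun z => powLogExpansion j (z + 1)) z :=
    DifferentiableAt.comp (g := powLogExpansion j) (f := fun z : ℂ => z + 1) z
      (differentiableAt_powLogExpansion j (Or.inl (by simp; linarith))) (by fun_prop)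
  rw [show funK j = fun z => _ from funext (funK_eq j)]
  exact (h2.sub_const _).add h1

theorem differentiableOn_funK (j : ℕ) :
    DifferentiableOn ℂ (funK j) {z : ℂ | z + 1 ∈ Complex.slitPlane} := by
  intro z hz
  obtain ⟨N, hN⟩ := exists_nat_re_add_pos z
  -- The difference equation carries holomorphy from the right half-plane back to the whole cut
  -- plane.
  have h1 : funK j =ᶠ[nhds z] fun z => funK j (z + N) -
      ∑ i ∈ Finset.range N, (z + i + 1) ^ j * Complex.log (z + i + 1) := by
    filter_upwards [isOpen_slitPlane_sub_one.mem_nhds hz] with w hw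
    rw [funK_add_natCast j hw]; ring
  refine (DifferentiableAt.congr_of_eventuallyEq ?_ h1).differentiableWithinAt
  refine (DifferentiableAt.comp z (differentiableAt_funK_of_re_pos j hN) (by fun_prop)).sub
    (DifferentiableAt.fun_sum fun i _ => ?_)
  have h : z + i + 1 ∈ Complex.slitPlane := by
    rw [add_right_comm]; exact Complex.add_natCast_mem_slitPlane hz i
  exact DifferentiableAt.mul (by fun_prop) (DifferentiableAt.clog (by fun_prop) h)

/-! ### Growth of the functions K_j on the right half-plane. -/

theorem Complex.norm_log_le_mul_sqrt {z : ℂ} (hz : 0 ≤ z.re) :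
    ‖Complex.log (z + 1)‖ ≤ 6 * √(1 + ‖z‖) := by
  have h1 : 1 ≤ ‖z + 1‖ := le_trans (by simpa using hz) (Complex.re_le_norm (z + 1))
  have h2 : ‖z + 1‖ ≤ 1 + ‖z‖ := by rw [add_comm 1]; simpa using norm_add_le z 1
  have hs : 1 ≤ √(1 + ‖z‖) := Real.one_le_sqrt.2 (by linarith [norm_nonneg z])
  have h3 : Real.log ‖z + 1‖ ≤ 2 * √(1 + ‖z‖) := by
    have e1 : Real.log ‖z + 1‖ ≤ Real.log (1 + ‖z‖) := Real.log_le_log (by linarith) h2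
    have e2 : Real.log (1 + ‖z‖) / 2 ≤ √(1 + ‖z‖) - 1 := by
      rw [← Real.log_sqrt (by positivity)]
      exact Real.log_le_sub_one_of_pos (by positivity)
    linarith
  have h4 : 0 ≤ Real.log ‖z + 1‖ := Real.log_nonneg h1
  calc ‖Complex.log (z + 1)‖ ≤ |(Complex.log (z + 1)).re| + |(Complex.log (z + 1)).im| :=
        Complex.norm_le_abs_re_add_abs_im _
    _ ≤ 2 * √(1 + ‖z‖) + Real.pi := by
        rw [Complex.log_re, Complex.log_im, abs_of_nonneg h4]
        exact add_le_add h3 (Complex.abs_arg_le_pi _)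
    _ ≤ _ := by nlinarith [Real.pi_le_four]

theorem exists_bound_powLogExpansion (j : ℕ) : ∃ C : ℝ, ∀ z : ℂ, 0 ≤ z.re →
    ‖powLogExpansion j (z + 1)‖ ≤ C * ((1 + ‖z‖) ^ (j + 1) * √(1 + ‖z‖)) := by
  refine ⟨∑ r ∈ Finset.range (j + 2), ‖((bernoulli r : ℚ) : ℂ) / (r.factorial : ℂ)‖ *
    (|powLogCoeff j r| * 6 + |powLogConst j r|), fun z hz => ?_⟩
  rw [powLogExpansion, Finset.sum_mul]
  refine norm_sum_le_of_le _ fun r hr => ?_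
  have hr : r ≤ j + 1 := by simp at hr; omega
  rw [norm_mul, mul_assoc]
  refine mul_le_mul_of_nonneg_left ?_ (norm_nonneg _)
  have h2 : ‖z + 1‖ ≤ 1 + ‖z‖ := by rw [add_comm 1]; simpa using norm_add_le z 1
  have hs : 1 ≤ √(1 + ‖z‖) := Real.one_le_sqrt.2 (by linarith [norm_nonneg z])
  rw [powLogDeriv, show (j : ℤ) + 1 - r = ((j + 1 - r : ℕ) : ℤ) by
    rw [Nat.cast_sub hr]; push_cast; ring, zpow_natCast, norm_mul, norm_pow, mul_left_comm]
  refine mul_le_mul ?_ ?_ (norm_nonneg _) (by positivity)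
  · calc ‖z + 1‖ ^ (j + 1 - r) ≤ (1 + ‖z‖) ^ (j + 1 - r) := by gcongr
      _ ≤ _ := pow_le_pow_right₀ (by linarith [norm_nonneg z]) (by omega)
  · refine (norm_add_le _ _).trans ?_
    rw [norm_mul, Complex.norm_real, Complex.norm_real, Real.norm_eq_abs, Real.norm_eq_abs]
    have := mul_le_mul_of_nonneg_left (Complex.norm_log_le_mul_sqrt hz)
      (abs_nonneg (powLogCoeff j r))
    nlinarith [abs_nonneg (powLogConst j r)]

/-- The square root absorbs the logarithm. Any exponent below 1 would do, since one extra derivative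
must beat it in the Cauchy estimates. -/
theorem exists_bound_funK (j : ℕ) : ∃ C : ℝ, 0 ≤ C ∧ ∀ z : ℂ, 0 ≤ z.re →
    ‖funK j z‖ ≤ C * ((1 + ‖z‖) ^ (j + 1) * √(1 + ‖z‖)) := by
  obtain ⟨C, hC⟩ := exists_bound_powLogExpansion j
  obtain ⟨u, hu, hb⟩ := exists_summable_bound_kTerm j
  have hu0 : 0 ≤ ∑' k, u k := tsum_nonneg fun k => (norm_nonneg _).trans (hb 0 le_rfl k)
  refine ⟨|C| + ‖deriv riemannZeta (-(j : ℂ))‖ + ∑' k, u k, by positivity, fun z hz => ?_⟩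
  have hs : 1 ≤ √(1 + ‖z‖) := Real.one_le_sqrt.2 (by linarith [norm_nonneg z])
  have hp : 1 ≤ (1 + ‖z‖) ^ (j + 1) := one_le_pow₀ (by linarith [norm_nonneg z])
  have hY : 1 ≤ (1 + ‖z‖) ^ (j + 1) * √(1 + ‖z‖) := by nlinarith
  have h1 : ‖∑' k : ℕ, kTerm j z (k + 1)‖ ≤ ∑' k, u k :=
    tsum_of_norm_bounded hu.hasSum (hb z hz)
  rw [funK_eq]
  refine (norm_add_le _ _).trans ((add_le_add ((norm_sub_le _ _).trans
    (add_le_add (hC z hz) le_rfl)) h1).trans ?_)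
  have h2 := le_abs_self C
  have h3 := norm_nonneg (deriv riemannZeta (-(j : ℂ)))
  nlinarith

/-! ### The derivative of the zeta function at `-j`, by Euler–Maclaurin summation -/

/-- The coefficient of `x ^ (1 - s - r)` in the `r`-th derivative of `x ^ (1 - s) / (s - 1)`. -/
noncomputable def cpowCoeff (s : ℂ) : ℕ → ℂ
  | 0 => (s - 1)⁻¹
  | r + 1 => cpowCoeff s r * (1 - s - r)

/-- The `r`-th derivative of `x ^ (1 - s) / (s - 1)`. -/
noncomputable def cpowDeriv (s : ℂ) (r : ℕ) (x : ℂ) : ℂ := cpowCoeff s r * x ^ (1 - s - r)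

theorem hasDerivAt_cpowDeriv (s : ℂ) (r : ℕ) {x : ℂ} (hx : x ∈ Complex.slitPlane) :
    HasDerivAt (cpowDeriv s r) (cpowDeriv s (r + 1) x) x := by
  have h := ((hasDerivAt_id x).cpow_const (c := 1 - s - r) hx).const_mul (cpowCoeff s r)
  refine h.congr_deriv ?_
  rw [cpowDeriv, cpowCoeff, show 1 - s - ((r + 1 : ℕ) : ℂ) = 1 - s - r - 1 by push_cast; ring]
  simp only [id]
  ring

theorem cpowDeriv_one {s : ℂ} (hs : s ≠ 1) (x : ℂ) : cpowDeriv s 1 x = -x ^ (-s) := by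
  have : s - 1 ≠ 0 := sub_ne_zero.2 hs
  rw [cpowDeriv, cpowCoeff, cpowCoeff, Nat.cast_zero, sub_zero, Nat.cast_one,
    show (s - 1)⁻¹ * (1 - s) = -1 by field_simp; ring, sub_right_comm, sub_self, zero_sub]
  ring

theorem cpowCoeff_neg_natCast (j r : ℕ) : cpowCoeff (-(j : ℂ)) r = -(powLogCoeff j r : ℂ) := by
  induction r with
  | zero =>
    rw [cpowCoeff, powLogCoeff, ← neg_add', inv_neg]; push_cast; rw [one_div]
  | succ r ih =>
    rw [cpowCoeff, powLogCoeff, ih]; push_cast; ring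

/-- Differentiating the recurrence of `cpowCoeff` in s at -j reproduces the recurrence of
`powLogConst`. -/
theorem hasDerivAt_cpowCoeff (j r : ℕ) :
    HasDerivAt (fun s => cpowCoeff s r) (powLogConst j r : ℂ) (-(j : ℂ)) := by
  have hj : (-(j : ℂ)) - 1 ≠ 0 := by
    rw [← neg_add', neg_ne_zero]; exact_mod_cast Nat.succ_ne_zero j
  induction r with
  | zero =>
    refine (((hasDerivAt_id (-(j : ℂ))).sub_const 1).inv hj).congr_deriv ?_
    rw [powLogConst]; push_cast; simp only [id]; rw [← neg_add', neg_sq]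
  | succ r ih =>
    have h := ih.mul (((hasDerivAt_id (-(j : ℂ))).const_sub 1).sub_const (r : ℂ))
    refine h.congr_deriv ?_
    rw [cpowCoeff_neg_natCast, powLogConst]
    push_cast
    simp only [id]
    ring

theorem differentiableAt_cpowCoeff {s : ℂ} (hs : s ≠ 1) (r : ℕ) :
    DifferentiableAt ℂ (fun s => cpowCoeff s r) s := by
  induction r with
  | zero => exact DifferentiableAt.inv (by fun_prop) (sub_ne_zero.2 hs)
  | succ r ih => exact ih.mul (by fun_prop)

theorem differentiableAt_cpowDeriv {s : ℂ} (hs : s ≠ 1) (r : ℕ) {x : ℂ} (hx : x ≠ 0) :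
    DifferentiableAt ℂ (fun s => cpowDeriv s r x) s :=
  (differentiableAt_cpowCoeff hs r).mul (DifferentiableAt.const_cpow (by fun_prop) (Or.inl hx))

theorem hasDerivAt_cpowDeriv_neg_natCast (j r : ℕ) {x : ℂ} (hx : x ≠ 0) :
    HasDerivAt (fun s => cpowDeriv s r x) (powLogDeriv j r x) (-(j : ℂ)) := by
  have h1 : HasDerivAt (fun s : ℂ => 1 - s - r) (-1) (-(j : ℂ)) :=
    ((hasDerivAt_id (-(j : ℂ))).const_sub 1).sub_const (r : ℂ)
  have h := (hasDerivAt_cpowCoeff j r).mul (h1.const_cpow (c := x) (Or.inl hx))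
  refine h.congr_deriv ?_
  have e : x ^ (1 - -(j : ℂ) - r) = x ^ ((j : ℤ) + 1 - r) := by
    rw [← Complex.cpow_intCast]; congr 1; push_cast; ring
  rw [cpowCoeff_neg_natCast, e, powLogDeriv]
  ring

/-- The Euler–Maclaurin expansion of the sum of `(x + k) ^ (-s)` over `k ≥ 0`. -/
noncomputable def cpowExpansion (j : ℕ) (s x : ℂ) : ℂ :=
  ∑ r ∈ Finset.range (j + 2), ((bernoulli r : ℚ) : ℂ) / (r.factorial : ℂ) * cpowDeriv s r x

/-- The error of the Euler–Maclaurin expansion on one unit interval. -/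
noncomputable def cpowTerm (j : ℕ) (s x : ℂ) : ℂ :=
  cpowExpansion j s (x + 1) - cpowExpansion j s x - cpowDeriv s 1 x

theorem differentiableAt_cpowExpansion (j : ℕ) {s : ℂ} (hs : s ≠ 1) {x : ℂ} (hx : x ≠ 0) :
    DifferentiableAt ℂ (fun s => cpowExpansion j s x) s :=
  DifferentiableAt.fun_sum fun r _ => (differentiableAt_cpowDeriv hs r hx).const_mul _

theorem hasDerivAt_cpowExpansion (j : ℕ) {x : ℂ} (hx : x ≠ 0) :
    HasDerivAt (fun s => cpowExpansion j s x) (powLogExpansion j x) (-(j : ℂ)) :=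
  HasDerivAt.fun_sum fun r _ => (hasDerivAt_cpowDeriv_neg_natCast j r hx).const_mul _

theorem norm_cpowTerm_le (j : ℕ) (s : ℂ) {x : ℝ} (hx : 0 < x) (hs : -(j : ℝ) - 2 ≤ s.re) :
    ‖cpowTerm j s x‖ ≤ eulerMaclaurinConst (j + 1) *
      (‖cpowCoeff s (j + 3)‖ * x ^ (-(j : ℝ) - 2 - s.re)) := by
  have := norm_eulerMaclaurin_le (F := fun r t => cpowDeriv s r (x + t))
    (C := ‖cpowCoeff s (j + 3)‖ * x ^ (-(j : ℝ) - 2 - s.re)) (fun r t ht => by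
      have hm : (x : ℂ) + t ∈ Complex.slitPlane := by left; simp; linarith [ht.1]
      have := (hasDerivAt_cpowDeriv s r hm).scomp t
        ((hasDerivAt_id t).ofReal_comp.const_add (x : ℂ))
      simpa [Function.comp_def] using this) (j + 1) (fun t ht => by
      have hxt : 0 < x + t := by linarith [ht.1]
      rw [cpowDeriv, norm_mul, show j + 1 + 2 = j + 3 by ring, ← Complex.ofReal_add,
        Complex.norm_cpow_eq_rpow_re_of_pos hxt]
      refine mul_le_mul_of_nonneg_left ?_ (norm_nonneg _)
      have e : (1 - s - ((j + 3 : ℕ) : ℂ)).re = -(j : ℝ) - 2 - s.re := by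
        simp; ring
      rw [e]
      exact Real.rpow_le_rpow_of_nonpos hx (by linarith [ht.1]) (by linarith))
  rw [cpowTerm, ← norm_neg]
  refine (congrArg norm ?_).trans_le this
  simp only [cpowExpansion, Complex.ofReal_zero, add_zero, Complex.ofReal_one, mul_sub,
    Finset.sum_sub_distrib]
  ring

/-- The partial sums telescope, and for Re s > 1 every power in the boundary term at N + 1 tends to
0. -/
theorem riemannZeta_eq_cpowExpansion_of_one_lt_re (j : ℕ) {s : ℂ} (hs : 1 < s.re)
    (hsum : Summable fun k : ℕ => cpowTerm j s (k + 1)) :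
    riemannZeta s = cpowExpansion j s 1 + ∑' k : ℕ, cpowTerm j s (k + 1) := by
  have hs1 : s ≠ 1 := by rintro rfl; simp at hs
  have hps : Summable fun k : ℕ => 1 / ((k : ℂ) + 1) ^ s := by
    have := (summable_nat_add_iff 1).2 (Complex.summable_one_div_nat_cpow.2 hs)
    simpa using this
  have h1 := hps.hasSum
  rw [← zeta_eq_tsum_one_div_nat_add_one_cpow hs] at h1
  have h2 : Filter.Tendsto (fun N : ℕ => cpowExpansion j s (N + 1)) Filter.atTop (nhds 0) := by
    rw [show (0 : ℂ) = ∑ r ∈ Finset.range (j + 2), 0 by simp]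
    refine tendsto_finsetSum _ fun r _ => ?_
    rw [show (0 : ℂ) = ((bernoulli r : ℚ) : ℂ) / (r.factorial : ℂ) * (cpowCoeff s r * 0) by simp]
    refine Filter.Tendsto.const_mul _ (Filter.Tendsto.const_mul _ ?_)
    rw [tendsto_zero_iff_norm_tendsto_zero]
    have h3 : Filter.Tendsto (fun N : ℕ => ((N : ℝ) + 1) ^ (-(s.re - 1 + r))) Filter.atTop
        (nhds 0) :=
      (tendsto_rpow_neg_atTop (by positivity [sub_pos.2 hs])).comp
        (Filter.tendsto_atTop_add_const_right _ _ tendsto_natCast_atTop_atTop)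
    refine h3.congr fun N => ?_
    rw [show (N : ℂ) + 1 = ((N + 1 : ℝ) : ℂ) by push_cast; rfl,
      Complex.norm_cpow_eq_rpow_re_of_pos (by positivity)]
    congr 1
    simp; ring
  have h3 : ∀ N : ℕ, ∑ k ∈ Finset.range N, cpowTerm j s (k + 1) =
      ∑ k ∈ Finset.range N, 1 / ((k : ℂ) + 1) ^ s + cpowExpansion j s (N + 1) -
        cpowExpansion j s 1 := by
    intro N
    induction N with
    | zero => simp
    | succ N ih =>
      rw [Finset.sum_range_succ, ih, Finset.sum_range_succ, cpowTerm, cpowDeriv_one hs1,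
        Complex.cpow_neg, one_div]
      push_cast
      ring
  have h4 := hsum.hasSum.tendsto_sum_nat
  simp_rw [h3] at h4
  have h5 := (h1.tendsto_sum_nat.add h2).sub_const (cpowExpansion j s 1)
  rw [tendsto_nhds_unique h4 h5]
  ring

/-- A bounded convex neighbourhood of `-j` that avoids `1` and meets `1 < re s`. -/
def zetaRegion (j : ℕ) : Set ℂ :=
  {s | -(j : ℝ) - 1 / 2 < s.re} ∩ {s | s.re - s.im < 1} ∩ Metric.ball 0 (j + 4)

theorem isOpen_zetaRegion (j : ℕ) : IsOpen (zetaRegion j) :=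
  ((isOpen_lt continuous_const Complex.continuous_re).inter
    (isOpen_lt (Complex.continuous_re.sub Complex.continuous_im) continuous_const)).inter
    Metric.isOpen_ball

theorem isPreconnected_zetaRegion (j : ℕ) : IsPreconnected (zetaRegion j) := by
  refine Convex.isPreconnected (((convex_halfSpace_gt ?_ _).inter (convex_halfSpace_lt ?_ _)).inter
    (convex_ball 0 _))
  · exact ⟨fun _ _ => rfl, fun _ _ => by simp⟩
  · exact ⟨fun _ _ => by simp; ring, fun _ _ => by simp; ring⟩

theorem ne_one_of_mem_zetaRegion {j : ℕ} {s : ℂ} (hs : s ∈ zetaRegion j) : s ≠ 1 := by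
  rintro rfl
  have : (1 : ℂ).re - (1 : ℂ).im < 1 := hs.1.2
  simp at this

/-- From order 1 on the pole (s - 1)⁻¹ is cancelled by the factor 1 - s, so the coefficients stay
bounded although 1 is a boundary point of the region. -/
theorem exists_bound_cpowCoeff (j r : ℕ) : ∃ C : ℝ, 0 ≤ C ∧ ∀ s ∈ zetaRegion j,
    ‖cpowCoeff s (r + 1)‖ ≤ C := by
  induction r with
  | zero =>
    refine ⟨1, zero_le_one, fun s hs => ?_⟩
    have : s - 1 ≠ 0 := sub_ne_zero.2 (ne_one_of_mem_zetaRegion hs)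
    rw [cpowCoeff, cpowCoeff, Nat.cast_zero, sub_zero,
      show (s - 1)⁻¹ * (1 - s) = -1 by field_simp; ring]
    simp
  | succ r ih =>
    obtain ⟨C, hC, h⟩ := ih
    refine ⟨C * (1 + (j + 4) + (r + 1)), by positivity, fun s hs => ?_⟩
    rw [cpowCoeff, norm_mul]
    refine mul_le_mul (h s hs) ?_ (norm_nonneg _) hC
    have h1 : ‖s‖ < j + 4 := by simpa using hs.2
    refine (norm_sub_le _ _).trans (add_le_add ((norm_sub_le _ _).trans ?_) ?_)
    · rw [norm_one]; linarith
    · rw [Complex.norm_natCast]; push_cast; rfl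

theorem exists_summable_bound_cpowTerm (j : ℕ) : ∃ u : ℕ → ℝ, Summable u ∧
    ∀ k : ℕ, ∀ s ∈ zetaRegion j, ‖cpowTerm j s (k + 1)‖ ≤ u k := by
  obtain ⟨C, hC, h⟩ := exists_bound_cpowCoeff j (j + 2)
  -- Since Re s > -j - 1/2, the exponent -j - 2 - Re s is below -3/2.
  refine ⟨fun k => eulerMaclaurinConst (j + 1) * (C * ((k : ℝ) + 1) ^ (-(3 / 2) : ℝ)), ?_, ?_⟩
  · refine (Summable.mul_left _ ?_).mul_left _
    have := (summable_nat_add_iff 1).2 (Real.summable_nat_rpow.2 (show -(3 / 2 : ℝ) < -1 by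
      norm_num))
    simpa using this
  · intro k s hs
    have hre : -(j : ℝ) - 1 / 2 < s.re := hs.1.1
    have hk : (0 : ℝ) ≤ k := k.cast_nonneg
    have h1 := norm_cpowTerm_le j s (x := k + 1) (by positivity) (by linarith)
    push_cast at h1
    refine h1.trans (mul_le_mul_of_nonneg_left ?_ (eulerMaclaurinConst_nonneg _))
    refine mul_le_mul (h s hs) ?_ (by positivity) hC
    exact Real.rpow_le_rpow_of_exponent_le (by linarith) (by linarith)

theorem natCast_add_one_ne_zero (k : ℕ) : (k : ℂ) + 1 ≠ 0 := by
  exact_mod_cast Nat.succ_ne_zero k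

theorem differentiableOn_cpowTerm (j k : ℕ) :
    DifferentiableOn ℂ (fun s => cpowTerm j s (k + 1)) (zetaRegion j) := by
  intro s hs
  have hs1 := ne_one_of_mem_zetaRegion hs
  have h1 := natCast_add_one_ne_zero k
  have h2 : (k : ℂ) + 1 + 1 ≠ 0 := by simpa using natCast_add_one_ne_zero (k + 1)
  exact (((differentiableAt_cpowExpansion j hs1 h2).sub
    (differentiableAt_cpowExpansion j hs1 h1)).sub
    (differentiableAt_cpowDeriv hs1 1 h1)).differentiableWithinAt

theorem riemannZeta_eq_cpowExpansion (j : ℕ) : Set.EqOn riemannZeta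
    (fun s => cpowExpansion j s 1 + ∑' k : ℕ, cpowTerm j s (k + 1)) (zetaRegion j) := by
  obtain ⟨u, hu, hb⟩ := exists_summable_bound_cpowTerm j
  have hd : DifferentiableOn ℂ
      (fun s => cpowExpansion j s 1 + ∑' k : ℕ, cpowTerm j s (k + 1)) (zetaRegion j) :=
    DifferentiableOn.add (fun s hs => (differentiableAt_cpowExpansion j
      (ne_one_of_mem_zetaRegion hs) one_ne_zero).differentiableWithinAt)
      (Complex.differentiableOn_tsum_of_summable_norm hu (differentiableOn_cpowTerm j)
        (isOpen_zetaRegion j) hb)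
  have hz : DifferentiableOn ℂ riemannZeta (zetaRegion j) := fun s hs =>
    (differentiableAt_riemannZeta (ne_one_of_mem_zetaRegion hs)).differentiableWithinAt
  -- Base point for the identity theorem: it lies in the region and has Re s > 1, where the
  -- Dirichlet series is available.
  have hmem : (2 + 2 * Complex.I : ℂ) ∈ zetaRegion j := by
    have hj : (0 : ℝ) ≤ j := j.cast_nonneg
    refine ⟨⟨?_, ?_⟩, ?_⟩
    · simp; linarith
    · simp
    · rw [mem_ball_zero_iff, Complex.norm_eq_sqrt_sq_add_sq, Real.sqrt_lt' (by positivity)]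
      simp
      nlinarith
  refine (hz.analyticOnNhd (isOpen_zetaRegion j)).eqOn_of_preconnected_of_eventuallyEq
    (hd.analyticOnNhd (isOpen_zetaRegion j)) (isPreconnected_zetaRegion j) hmem ?_
  have ho : IsOpen {s : ℂ | 1 < s.re} := isOpen_lt continuous_const Complex.continuous_re
  filter_upwards [(isOpen_zetaRegion j).mem_nhds hmem, ho.mem_nhds (by simp)] with s hs hs1
  exact riemannZeta_eq_cpowExpansion_of_one_lt_re j hs1 (Summable.of_norm_bounded hu fun k => hb k s hs)

/-- Termwise differentiation in s at -j turns the errors for x^(-s) into the summands of K_j at z =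
0. -/
theorem deriv_riemannZeta_neg_natCast (j : ℕ) : deriv riemannZeta (-(j : ℂ)) =
    powLogExpansion j 1 + ∑' k : ℕ, kTerm j 0 (k + 1) := by
  obtain ⟨u, hu, hb⟩ := exists_summable_bound_cpowTerm j
  have hmem : -(j : ℂ) ∈ zetaRegion j := by
    have hj : (0 : ℝ) ≤ j := j.cast_nonneg
    refine ⟨⟨?_, ?_⟩, ?_⟩
    · simp
    · simp; linarith
    · simp
  have hs := Complex.hasSum_deriv_of_summable_norm hu (differentiableOn_cpowTerm j)
    (isOpen_zetaRegion j) hb hmem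
  have hterm : ∀ k : ℕ, deriv (fun s => cpowTerm j s (k + 1)) (-(j : ℂ)) = kTerm j 0 (k + 1) := by
    intro k
    have h1 := natCast_add_one_ne_zero k
    have h2 : (k : ℂ) + 1 + 1 ≠ 0 := by simpa using natCast_add_one_ne_zero (k + 1)
    have h := ((hasDerivAt_cpowExpansion j h2).sub (hasDerivAt_cpowExpansion j h1)).sub
      (hasDerivAt_cpowDeriv_neg_natCast j 1 h1)
    rw [kTerm_eq j 0 (k + 1) (Or.inl (by simp; positivity))]
    push_cast
    rw [zero_add]
    exact h.deriv
  simp_rw [hterm] at hs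
  have hdt := (Complex.differentiableOn_tsum_of_summable_norm hu (differentiableOn_cpowTerm j)
        (isOpen_zetaRegion j) hb).differentiableAt ((isOpen_zetaRegion j).mem_nhds hmem)
  rw [((riemannZeta_eq_cpowExpansion j).eventuallyEq_of_mem
    ((isOpen_zetaRegion j).mem_nhds hmem)).deriv_eq, hs.tsum_eq]
  exact ((hasDerivAt_cpowExpansion j one_ne_zero).add hdt.hasDerivAt).deriv

theorem funK_zero (j : ℕ) : funK j 0 = 0 := by
  rw [funK_eq, deriv_riemannZeta_neg_natCast, zero_add]
  ring

/-! ### The coefficients of `(z - u).choose (n - 1)` -/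

theorem natDegree_descPochhammer_comp_le (m : ℕ) (z : ℂ) :
    (Polynomial.C ((m.factorial : ℂ)⁻¹) *
      (descPochhammer ℂ m).comp (Polynomial.C z - Polynomial.X)).natDegree ≤ m := by
  refine (Polynomial.natDegree_C_mul_le _ _).trans (Polynomial.natDegree_comp_le.trans ?_)
  rw [descPochhammer_natDegree]
  have : (Polynomial.C z - Polynomial.X).natDegree ≤ 1 :=
    (Polynomial.natDegree_sub_le _ _).trans (by simp)
  exact (Nat.mul_le_mul_left m this).trans (by simp)

theorem sum_binomCoeffPoly_mul_pow (m : ℕ) (z u : ℂ) :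
    ∑ j ∈ Finset.range (m + 1), binomCoeffPoly (m + 1) j z * u ^ j =
      (m.factorial : ℂ)⁻¹ * (descPochhammer ℂ m).eval (z - u) := by
  have := Polynomial.eval_eq_sum_range' (Nat.lt_succ_of_le (natDegree_descPochhammer_comp_le m z)) u
  simp only [Polynomial.eval_mul, Polynomial.eval_C, Polynomial.eval_comp, Polynomial.eval_sub,
    Polynomial.eval_X] at this
  rw [this]
  rfl

theorem binomCoeffPoly_eq_zero (m : ℕ) (z : ℂ) : binomCoeffPoly (m + 1) (m + 1) z = 0 :=
  Polynomial.coeff_eq_zero_of_natDegree_lt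
    (Nat.lt_succ_of_le (natDegree_descPochhammer_comp_le m z))

/-- Pascal's rule in z, compared coefficientwise in u. -/
theorem binomCoeffPoly_add_one (m j : ℕ) (z : ℂ) : binomCoeffPoly (m + 2) j (z + 1) =
    binomCoeffPoly (m + 2) j z + binomCoeffPoly (m + 1) j z := by
  have h := congrArg (fun p : Polynomial ℂ => p.comp (Polynomial.C (z + 1) - Polynomial.X))
    (descPochhammer_succ_comp_X_sub_one (R := ℂ) m)
  have e : (Polynomial.C (z + 1) - Polynomial.X : Polynomial ℂ) - 1 =
      Polynomial.C z - Polynomial.X := by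
    rw [Polynomial.C_add, Polynomial.C_1]; ring
  have em : (m : Polynomial ℂ) + 1 = Polynomial.C ((m : ℂ) + 1) := by simp
  simp only [em, smul_eq_mul, Polynomial.mul_comp, Polynomial.C_comp, Polynomial.comp_assoc,
    Polynomial.sub_comp, Polynomial.X_comp, Polynomial.one_comp, e] at h
  have hm : (((m + 1).factorial : ℂ)⁻¹) * (m + 1) = (m.factorial : ℂ)⁻¹ := by
    have h1 : (m : ℂ) + 1 ≠ 0 := by exact_mod_cast Nat.succ_ne_zero m
    have h2 : (m.factorial : ℂ) ≠ 0 := by exact_mod_cast m.factorial_ne_zero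
    rw [Nat.factorial_succ]; push_cast; field_simp
  have h3 := congrArg (fun p : Polynomial ℂ => p.coeff j) h
  simp only [Polynomial.coeff_sub, Polynomial.coeff_C_mul] at h3
  simp only [binomCoeffPoly, Polynomial.coeff_C_mul, show m + 2 - 1 = m + 1 by omega,
    show m + 1 - 1 = m by omega]
  rw [← hm, h3]
  ring

theorem descPochhammer_comp_coeff_succ (m j : ℕ) (z : ℂ) :
    ((descPochhammer ℂ (m + 1)).comp (Polynomial.C z - Polynomial.X)).coeff j =
      (z - m) * ((descPochhammer ℂ m).comp (Polynomial.C z - Polynomial.X)).coeff j -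
      (Polynomial.X * (descPochhammer ℂ m).comp (Polynomial.C z - Polynomial.X)).coeff j := by
  have : (descPochhammer ℂ (m + 1)).comp (Polynomial.C z - Polynomial.X) =
      Polynomial.C (z - m) * (descPochhammer ℂ m).comp (Polynomial.C z - Polynomial.X) -
      Polynomial.X * (descPochhammer ℂ m).comp (Polynomial.C z - Polynomial.X) := by
    rw [descPochhammer_succ_right]
    simp
    ring
  rw [this, Polynomial.coeff_sub, Polynomial.coeff_C_mul]

theorem differentiable_descPochhammer_comp_coeff (m : ℕ) : ∀ j, Differentiable ℂ
    fun z => ((descPochhammer ℂ m).comp (Polynomial.C z - Polynomial.X)).coeff j := by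
  induction m with
  | zero => intro j; simp
  | succ m ih =>
    intro j
    simp_rw [descPochhammer_comp_coeff_succ]
    rcases j with _ | j
    · simp_rw [Polynomial.coeff_X_mul_zero, sub_zero]
      exact Differentiable.fun_mul (by fun_prop) (ih 0)
    · simp_rw [Polynomial.coeff_X_mul]
      exact (Differentiable.mul (by fun_prop) (ih (j + 1))).sub (ih j)

theorem differentiable_binomCoeffPoly (n j : ℕ) : Differentiable ℂ (binomCoeffPoly n j) := by
  have : binomCoeffPoly n j = fun z => (((n - 1).factorial : ℂ)⁻¹) *
      ((descPochhammer ℂ (n - 1)).comp (Polynomial.C z - Polynomial.X)).coeff j :=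
    funext fun z => Polynomial.coeff_C_mul _
  rw [this]
  exact (differentiable_descPochhammer_comp_coeff _ j).const_mul _

/-- The polynomial has total degree m in (z, u), so its coefficient of u^j has degree at most m - j
in z. -/
theorem exists_bound_descPochhammer_comp_coeff (m : ℕ) : ∃ C : ℝ, 0 ≤ C ∧ ∀ (j : ℕ) (z : ℂ),
    ‖((descPochhammer ℂ m).comp (Polynomial.C z - Polynomial.X)).coeff j‖ * (1 + ‖z‖) ^ j ≤
      C * (1 + ‖z‖) ^ m := by
  induction m with
  | zero =>
    refine ⟨1, zero_le_one, fun j z => ?_⟩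
    rcases j with _ | j <;> simp [Polynomial.coeff_one]
  | succ m ih =>
    obtain ⟨C, hC, h⟩ := ih
    refine ⟨(m + 1) * C + C, by positivity, fun j z => ?_⟩
    have hz := norm_nonneg z
    rw [descPochhammer_comp_coeff_succ]
    refine (mul_le_mul_of_nonneg_right (norm_sub_le _ _) (by positivity)).trans ?_
    rw [add_mul, add_mul]
    refine add_le_add ?_ ?_
    · rw [norm_mul, mul_assoc]
      have h1 : ‖z - m‖ ≤ (m + 1) * (1 + ‖z‖) := by
        refine (norm_sub_le _ _).trans ?_
        rw [Complex.norm_natCast]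
        nlinarith [m.cast_nonneg (α := ℝ), mul_nonneg (m.cast_nonneg (α := ℝ)) hz]
      calc _ ≤ ((m + 1) * (1 + ‖z‖)) * (C * (1 + ‖z‖) ^ m) :=
            mul_le_mul h1 (h j z) (by positivity) (by positivity)
        _ = _ := by ring
    · rcases j with _ | j
      · simp; positivity
      · rw [Polynomial.coeff_X_mul, pow_succ, ← mul_assoc, pow_succ, ← mul_assoc]
        exact mul_le_mul_of_nonneg_right (h j z) (by positivity)

theorem exists_bound_binomCoeffPoly (m j : ℕ) : ∃ C : ℝ, 0 ≤ C ∧ ∀ z : ℂ,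
    ‖binomCoeffPoly (m + 1) j z‖ * (1 + ‖z‖) ^ j ≤ C * (1 + ‖z‖) ^ m := by
  obtain ⟨C, hC, h⟩ := exists_bound_descPochhammer_comp_coeff m
  refine ⟨‖(m.factorial : ℂ)⁻¹‖ * C, by positivity, fun z => ?_⟩
  rw [show binomCoeffPoly (m + 1) j z = ((m.factorial : ℂ)⁻¹) *
    ((descPochhammer ℂ m).comp (Polynomial.C z - Polynomial.X)).coeff j from
    Polynomial.coeff_C_mul _, norm_mul, mul_assoc, mul_assoc]
  exact mul_le_mul_of_nonneg_left (h j z) (norm_nonneg _)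

/-! ### The logarithms of the multiple gamma functions -/

/-- The logarithm of the `n`-th multiple gamma function at `z + 1`. -/
noncomputable def logMultipleGamma : ℕ → ℂ → ℂ
  | 0, z => Complex.log (z + 1)
  | n + 1, z => ∑ j ∈ Finset.range (n + 1), binomCoeffPoly (n + 1) j z * funK j z

theorem logMultipleGamma_zero_right (n : ℕ) : logMultipleGamma n 0 = 0 := by
  cases n <;> simp [logMultipleGamma, funK_zero]

theorem logMultipleGamma_add_one (n : ℕ) {z : ℂ} (hz : z + 1 ∈ Complex.slitPlane) :
    logMultipleGamma (n + 1) (z + 1) = logMultipleGamma (n + 1) z + logMultipleGamma n z := by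
  rw [logMultipleGamma]
  simp_rw [funK_add_one _ hz, mul_add, ← mul_assoc]
  -- The logarithmic terms add up to the binomial polynomial at u = z + 1, that is 0 choose n. This
  -- is 1 for n = 0, giving `logMultipleGamma 0`, and 0 afterwards.
  rw [Finset.sum_add_distrib, ← Finset.sum_mul, sum_binomCoeffPoly_mul_pow, sub_self]
  cases n with
  | zero =>
    simp [logMultipleGamma, binomCoeffPoly]
  | succ n =>
    simp_rw [binomCoeffPoly_add_one, add_mul]
    rw [Finset.sum_add_distrib, Finset.sum_range_succ (fun j => binomCoeffPoly (n + 1) j z * _),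
      binomCoeffPoly_eq_zero]
    simp [logMultipleGamma]

theorem differentiableOn_logMultipleGamma (n : ℕ) :
    DifferentiableOn ℂ (logMultipleGamma n) {z : ℂ | z + 1 ∈ Complex.slitPlane} := by
  cases n with
  | zero =>
    intro z hz
    have h1 : DifferentiableAt ℂ (fun z : ℂ => z + 1) z := by fun_prop
    exact (h1.clog hz).differentiableWithinAt
  | succ n =>
    exact DifferentiableOn.fun_sum fun j _ =>
      (differentiable_binomCoeffPoly _ j).differentiableOn.mul (differentiableOn_funK j)

theorem analyticAt_logMultipleGamma (n : ℕ) {z : ℂ} (hz : z + 1 ∈ Complex.slitPlane) :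
    AnalyticAt ℂ (logMultipleGamma n) z :=
  (differentiableOn_logMultipleGamma n).analyticAt (isOpen_slitPlane_sub_one.mem_nhds hz)

/-- The growth |z|^(n-j) of the coefficient compensates the growth |z|^(j+3/2) of K_j, for every j
alike. -/
theorem exists_bound_logMultipleGamma (n : ℕ) : ∃ C : ℝ, 0 ≤ C ∧ ∀ z : ℂ, 0 ≤ z.re →
    ‖logMultipleGamma n z‖ ≤ C * ((1 + ‖z‖) ^ n * √(1 + ‖z‖)) := by
  cases n with
  | zero => exact ⟨6, by norm_num, fun z hz => by
      simpa [logMultipleGamma] using Complex.norm_log_le_mul_sqrt hz⟩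
  | succ n =>
    choose A hA hA' using exists_bound_binomCoeffPoly n
    choose B hB hB' using exists_bound_funK
    refine ⟨∑ j ∈ Finset.range (n + 1), A j * B j,
      Finset.sum_nonneg fun j _ => mul_nonneg (hA j) (hB j), fun z hz => ?_⟩
    rw [logMultipleGamma, Finset.sum_mul]
    refine norm_sum_le_of_le _ fun j _ => ?_
    have hz := norm_nonneg z
    rw [norm_mul]
    calc _ ≤ ‖binomCoeffPoly (n + 1) j z‖ * (B j * ((1 + ‖z‖) ^ (j + 1) * √(1 + ‖z‖))) :=
          mul_le_mul_of_nonneg_left (hB' j z ‹_›) (norm_nonneg _)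
      _ = (‖binomCoeffPoly (n + 1) j z‖ * (1 + ‖z‖) ^ j) *
          (B j * ((1 + ‖z‖) * √(1 + ‖z‖))) := by ring
      _ ≤ (A j * (1 + ‖z‖) ^ n) * (B j * ((1 + ‖z‖) * √(1 + ‖z‖))) :=
          mul_le_mul_of_nonneg_right (hA' j z) (mul_nonneg (hB j) (by positivity))
      _ = _ := by ring

/-- The derivatives of order larger than `n` tend to `0`, by the Cauchy estimates. -/
theorem tendsto_iteratedDeriv_logMultipleGamma (n m : ℕ) (hm : n < m) :
    Filter.Tendsto (fun x : ℝ => iteratedDeriv m (logMultipleGamma n) x) Filter.atTop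
      (nhds 0) := by
  obtain ⟨C, hC, hb⟩ := exists_bound_logMultipleGamma n
  have hlim : Filter.Tendsto (fun x : ℝ => ((m.factorial : ℝ) * C * 2 ^ m * 3 ^ (n + 1)) *
      x ^ (-(1 / 2) : ℝ)) Filter.atTop (nhds 0) := by
    simpa using (tendsto_rpow_neg_atTop (show (0 : ℝ) < 1 / 2 by norm_num)).const_mul
      ((m.factorial : ℝ) * C * 2 ^ m * 3 ^ (n + 1))
  refine squeeze_zero_norm' ?_ hlim
  filter_upwards [Filter.eventually_ge_atTop 1] with x hx
  have hx0 : 0 < x := by linarith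
  -- Radius x/2 keeps the disc in the right half-plane while 1 + |z| ≤ 3x. The estimate is then of
  -- order x^(n+1/2-m) ≤ x^(-1/2).
  have hsub : Metric.closedBall (x : ℂ) (x / 2) ⊆ {z : ℂ | 0 < z.re} := by
    intro z hz
    rw [mem_closedBall_iff_norm] at hz
    have := (abs_le.1 ((Complex.abs_re_le_norm _).trans hz)).1
    simp at this
    simp only [Set.mem_ofPred_eq]
    linarith
  have h := Complex.norm_iteratedDeriv_le_of_forall_mem_sphere_norm_le (f := logMultipleGamma n)
    (C := C * ((3 * x) ^ n * (3 * √x))) m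
    (c := (x : ℂ)) (R := x / 2) (by positivity) (by
      refine DifferentiableOn.diffContOnCl ?_
      rw [closure_ball _ (by positivity)]
      refine (differentiableOn_logMultipleGamma n).mono fun z hz => ?_
      have : 0 < z.re := hsub hz
      left
      simp
      linarith) (fun z hz => by
      have hz1 : 0 < z.re := hsub (Metric.sphere_subset_closedBall hz)
      have hz2 : 1 + ‖z‖ ≤ 3 * x := by
        rw [mem_sphere_iff_norm] at hz
        have := norm_le_norm_add_norm_sub' z x
        rw [hz, Complex.norm_real, Real.norm_of_nonneg hx0.le] at this
        linarith
      refine (hb z hz1.le).trans (mul_le_mul_of_nonneg_left ?_ hC)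
      refine mul_le_mul (pow_le_pow_left₀ (by positivity) hz2 n) ?_ (by positivity)
        (by positivity)
      calc √(1 + ‖z‖) ≤ √(3 ^ 2 * x) := Real.sqrt_le_sqrt (by linarith)
        _ = 3 * √x := by rw [Real.sqrt_mul (by norm_num), Real.sqrt_sq (by norm_num)])
  refine h.trans ?_
  have hs : √x = x * x ^ (-(1 / 2) : ℝ) := by
    rw [Real.sqrt_eq_rpow, ← Real.rpow_one_add' hx0.le (by norm_num)]
    norm_num
  rw [hs, div_pow]
  obtain ⟨d, rfl⟩ := Nat.exists_eq_add_of_lt hm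
  have hd : 1 ≤ x ^ d := one_le_pow₀ hx
  have e : (n + d + 1).factorial * (C * ((3 * x) ^ n * (3 * (x * x ^ (-(1 / 2) : ℝ))))) /
      (x ^ (n + d + 1) / 2 ^ (n + d + 1)) =
      ((n + d + 1).factorial * C * 2 ^ (n + d + 1) * 3 ^ (n + 1) * x ^ (-(1 / 2) : ℝ)) / x ^ d := by
    field_simp
    ring
  rw [e]
  exact div_le_self (by positivity) hd

/-! ### Periodic functions with derivative bounded below -/

/-- A `1`-periodic function on a half-line that vanishes somewhere, and one of whose derivatives is bounded
below by a function
tending to `0`, is zero. -/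
theorem eq_zero_of_periodic_of_le_deriv {u : ℕ → ℝ → ℝ} {a : ℝ}
    (hu : ∀ i, ∀ x, a < x → HasDerivAt (u i) (u (i + 1) x) x)
    (hp : ∀ x, a < x → u 0 (x + 1) = u 0 x) {v : ℝ → ℝ}
    (hv : Filter.Tendsto v Filter.atTop (nhds 0)) {n : ℕ}
    (hle : ∀ x, a < x → v x ≤ u (n + 1) x) {p : ℝ} (hap : a < p) (h0 : u 0 p = 0) :
    ∀ x, a < x → u 0 x = 0 := by
  have per : ∀ i, ∀ x, a < x → u i (x + 1) = u i x := by
    intro i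
    induction i with
    | zero => exact hp
    | succ i ih =>
      intro x hx
      have h1 : HasDerivAt (fun y => u i (y + 1)) (u (i + 1) (x + 1)) x :=
        (hu i (x + 1) (by linarith)).comp_add_const x 1
      refine (h1.congr_of_eventuallyEq ?_).unique (hu i x hx)
      filter_upwards [lt_mem_nhds hx] with y hy using (ih y hy).symm
  have perN : ∀ i, ∀ N : ℕ, ∀ x, a < x → u i (x + N) = u i x := by
    intro i N x hx
    induction N with
    | zero => simp
    | succ N ih =>
      rw [Nat.cast_succ, ← add_assoc, per i _ (by linarith [N.cast_nonneg (α := ℝ)]), ih]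
  -- A monotone periodic function is constant.
  have const : ∀ i, (∀ x, a < x → 0 ≤ u (i + 1) x) → ∀ x y, a < x → x ≤ y → u i x = u i y := by
    intro i hi x y hx hxy
    have mono : MonotoneOn (u i) (Set.Ioi a) := by
      refine monotoneOn_of_deriv_nonneg (convex_Ioi a)
        (fun x hx => (hu i x hx).continuousAt.continuousWithinAt) ?_ ?_
      · rw [interior_Ioi]
        exact fun x hx => (hu i x hx).differentiableAt.differentiableWithinAt
      · rw [interior_Ioi]
        exact fun x hx => by rw [(hu i x hx).deriv]; exact hi x hx
    obtain ⟨N, hN⟩ := exists_nat_ge (y - x)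
    refine le_antisymm (mono hx (hx.trans_le hxy) hxy) ?_
    rw [← perN i N x hx]
    exact mono (hx.trans_le hxy) (show a < x + N by linarith) (by linarith)
  have nonneg : ∀ x, a < x → 0 ≤ u (n + 1) x := by
    intro x hx
    have h1 : Filter.Tendsto (fun N : ℕ => v (x + N)) Filter.atTop (nhds 0) :=
      hv.comp (Filter.tendsto_atTop_add_const_left _ _ tendsto_natCast_atTop_atTop)
    refine le_of_tendsto' h1 fun N => ?_
    rw [← perN (n + 1) N x hx]
    exact hle _ (by linarith [N.cast_nonneg (α := ℝ)])
  -- Descent in the order: `u (i + 1)` is constant, and Rolle's theorem over one period of `u i`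
  -- gives it a zero, so it vanishes identically.
  have key : ∀ i, (∀ x, a < x → 0 ≤ u (i + 1) x) → ∀ x, a < x → 0 ≤ u 1 x := by
    intro i
    induction i with
    | zero => exact id
    | succ i ih =>
      refine fun h => ih fun x hx => ?_
      obtain ⟨c, hc, hc0⟩ := exists_hasDerivAt_eq_zero (f := u i) (f' := u (i + 1))
        (lt_add_one x) (fun y hy => (hu i y (by linarith [hy.1])).continuousAt.continuousWithinAt)
        (per i x hx).symm (fun y hy => hu i y (by linarith [hy.1]))
      exact (const (i + 1) h x c hx hc.1.le).trans hc0 |>.ge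
  have hc := const 0 (key n nonneg)
  intro x hx
  rcases le_total x p with h | h
  · rw [hc x p hx h, h0]
  · rw [← hc p x hap h, h0]

/-! ### Derivatives along the real axis -/

theorem AnalyticAt.hasDerivAt_iteratedDeriv {f : ℂ → ℂ} {z : ℂ} (hf : AnalyticAt ℂ f z) (m : ℕ) :
    HasDerivAt (iteratedDeriv m f) (iteratedDeriv (m + 1) f z) z := by
  rw [iteratedDeriv_succ]
  have : AnalyticAt ℂ (iteratedDeriv m f) z := by
    rw [iteratedDeriv_eq_iterate]; exact hf.iterated_deriv m
  exact this.differentiableAt.hasDerivAt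

theorem iteratedDeriv_re_comp_ofReal {f : ℂ → ℂ} (m : ℕ) : ∀ {x : ℝ}, AnalyticAt ℂ f x →
    iteratedDeriv m (fun t : ℝ => (f t).re) x = (iteratedDeriv m f x).re := by
  induction m with
  | zero => intro x _; simp
  | succ m ih =>
    intro x hf
    rw [iteratedDeriv_succ]
    have h1 : HasDerivAt (fun t : ℝ => (iteratedDeriv m f t).re) (iteratedDeriv (m + 1) f x).re x :=
      (hf.hasDerivAt_iteratedDeriv m).real_of_complex
    rw [← h1.deriv]
    apply Filter.EventuallyEq.deriv_eq
    filter_upwards [Complex.continuous_ofReal.continuousAt.eventually hf.eventually_analyticAt]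
      with t ht using ih ht

theorem ofReal_add_one_mem_slitPlane {x : ℝ} (hx : -1 < x) : (x : ℂ) + 1 ∈ Complex.slitPlane := by
  left; simp; linarith

theorem iteratedDeriv_logMultipleGamma_add_one (n m : ℕ) {x : ℝ} (hx : -1 < x) :
    iteratedDeriv m (logMultipleGamma (n + 1)) ((x + 1 : ℝ) : ℂ) =
      iteratedDeriv m (logMultipleGamma (n + 1)) x + iteratedDeriv m (logMultipleGamma n) x := by
  have hD := ofReal_add_one_mem_slitPlane hx
  have h1 : iteratedDeriv m (fun z => logMultipleGamma (n + 1) (z + 1)) x =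
      iteratedDeriv m (logMultipleGamma (n + 1)) ((x + 1 : ℝ) : ℂ) := by
    rw [iteratedDeriv_comp_add_const]; push_cast; rfl
  rw [← h1, ← iteratedDeriv_fun_add (analyticAt_logMultipleGamma (n + 1) hD).contDiffAt
    (analyticAt_logMultipleGamma n hD).contDiffAt]
  apply Filter.EventuallyEq.iteratedDeriv_eq
  filter_upwards [isOpen_slitPlane_sub_one.mem_nhds hD] with z hz
    using logMultipleGamma_add_one n hz

theorem iteratedDeriv_logMultipleGamma_zero (m : ℕ) : ∀ {z : ℂ}, z + 1 ∈ Complex.slitPlane →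
    iteratedDeriv (m + 1) (logMultipleGamma 0) z =
      (-1) ^ m * (m.factorial : ℂ) * (z + 1) ^ (-(m + 1 : ℤ)) := by
  induction m with
  | zero =>
    intro z hz
    have h1 : HasDerivAt (logMultipleGamma 0) (1 / (z + 1)) z :=
      ((hasDerivAt_id z).add_const (1 : ℂ)).clog hz
    simp [h1.deriv]
  | succ m ih =>
    intro z hz
    have h0 := Complex.slitPlane_ne_zero hz
    have h2 := ((hasDerivAt_zpow (-(m + 1 : ℤ)) (z + 1) (Or.inl h0)).comp_add_const z 1).const_mul
      ((-1) ^ m * (m.factorial : ℂ))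
    have h3 : iteratedDeriv (m + 1) (logMultipleGamma 0) =ᶠ[nhds z]
        fun z => (-1) ^ m * (m.factorial : ℂ) * (z + 1) ^ (-(m + 1 : ℤ)) := by
      filter_upwards [isOpen_slitPlane_sub_one.mem_nhds hz] with w hw using ih hw
    rw [iteratedDeriv_succ, h3.deriv_eq, h2.deriv, Nat.factorial_succ,
      show -((m : ℤ) + 1) - 1 = -(((m + 1 : ℕ) : ℤ) + 1) by push_cast; ring]
    push_cast
    ring

/-- The derivatives of order larger than `n` of `log G_n` alternate in sign. -/
theorem iteratedDeriv_logMultipleGamma_sign (n : ℕ) : ∀ m : ℕ, n < m → ∀ x : ℝ, -1 < x →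
    0 ≤ (-1) ^ (m + n + 1) * (iteratedDeriv m (logMultipleGamma n) x).re := by
  induction n with
  | zero =>
    intro m hm x hx
    obtain ⟨m, rfl⟩ := Nat.exists_eq_add_of_lt hm
    rw [zero_add, iteratedDeriv_logMultipleGamma_zero m (ofReal_add_one_mem_slitPlane hx)]
    have h1 : ((-1) ^ m * (m.factorial : ℂ) * ((x : ℂ) + 1) ^ (-(m + 1 : ℤ))) =
        (((-1) ^ m * (m.factorial : ℝ) * (x + 1) ^ (-(m + 1 : ℤ)) : ℝ) : ℂ) := by push_cast; rfl
    rw [h1, Complex.ofReal_re, mul_assoc, ← mul_assoc, ← pow_add,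
      show m + 1 + 0 + 1 + m = 2 * (m + 1) by ring, pow_mul]
    have : 0 < x + 1 := by linarith
    simp only [even_two, Even.neg_pow, one_pow, one_mul]
    positivity
  | succ n ih =>
    intro m hm x hx
    set g : ℝ → ℝ := fun x =>
      (-1) ^ (m + (n + 1) + 1) * (iteratedDeriv m (logMultipleGamma (n + 1)) x).re with hg
    -- The increment is the derivative of `logMultipleGamma n`, whose sign is opposite by induction.
    -- So `g` decreases along x + N to its limit 0.
    have hstep : ∀ x : ℝ, -1 < x → g (x + 1) ≤ g x := by
      intro x hx
      have h1 := ih m (by omega) x hx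
      simp only [hg]
      rw [iteratedDeriv_logMultipleGamma_add_one n m hx, Complex.add_re]
      rw [show m + (n + 1) + 1 = (m + n + 1) + 1 by ring, pow_succ]
      linarith
    have hN : ∀ N : ℕ, g (x + N) ≤ g x := by
      intro N
      induction N with
      | zero => simp
      | succ N ihN =>
        rw [Nat.cast_succ, ← add_assoc]
        exact (hstep _ (by linarith [N.cast_nonneg (α := ℝ)])).trans ihN
    have hlim : Filter.Tendsto (fun N : ℕ => g (x + N)) Filter.atTop (nhds 0) := by
      have h1 := (Complex.continuous_re.tendsto 0).comp
        (tendsto_iteratedDeriv_logMultipleGamma (n + 1) m hm)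
      have h2 := h1.const_mul ((-1) ^ (m + (n + 1) + 1))
      rw [Complex.zero_re, mul_zero] at h2
      exact h2.comp (Filter.tendsto_atTop_add_const_left _ _ tendsto_natCast_atTop_atTop)
    exact le_of_tendsto' hlim hN

/-- Realness follows from the periodicity lemma: the imaginary part is 1-periodic because the
previous level is real, its high derivatives tend to 0, and it vanishes at 0. -/
theorem logMultipleGamma_im (n : ℕ) : ∀ x : ℝ, -1 < x → (logMultipleGamma n x).im = 0 := by
  induction n with
  | zero =>
    intro x hx
    rw [logMultipleGamma, ← Complex.ofReal_one, ← Complex.ofReal_add,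
      ← Complex.ofReal_log (by linarith), Complex.ofReal_im]
  | succ n ih =>
    set f : ℂ → ℂ := fun z => -Complex.I * logMultipleGamma (n + 1) z with hf
    have hre : ∀ x : ℝ, (f x).re = (logMultipleGamma (n + 1) x).im := fun x => by simp [hf]
    have hfa : ∀ x : ℝ, -1 < x → AnalyticAt ℂ f x := fun x hx =>
      analyticAt_const.mul (analyticAt_logMultipleGamma (n + 1) (ofReal_add_one_mem_slitPlane hx))
    have h := eq_zero_of_periodic_of_le_deriv (u := fun i x => (iteratedDeriv i f x).re) (a := -1)
      (fun i x hx => ((hfa x hx).hasDerivAt_iteratedDeriv i).real_of_complex)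
      (fun x hx => by
        simp only [iteratedDeriv_zero]
        rw [hre, hre]
        push_cast
        rw [logMultipleGamma_add_one n (ofReal_add_one_mem_slitPlane hx), Complex.add_im, ih x hx,
          add_zero])
      (v := fun x => (iteratedDeriv (n + 2) f x).re) (n := n + 1) (by
        have h1 : ∀ x : ℂ, iteratedDeriv (n + 2) f x =
            -Complex.I * iteratedDeriv (n + 2) (logMultipleGamma (n + 1)) x := fun x =>
          iteratedDeriv_const_mul_field _ _
        have h2 := (Complex.continuous_re.tendsto _).comp
          ((tendsto_iteratedDeriv_logMultipleGamma (n + 1) (n + 2) (by omega)).const_mul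
            (-Complex.I))
        simp_rw [h1]
        simpa [Function.comp_def] using h2)
      (fun x _ => le_rfl) (p := 0) (by norm_num) (by
        simp [hf, logMultipleGamma_zero_right])
    intro x hx
    rw [← hre]
    simpa using h x hx

theorem logMultipleGamma_ofReal (n : ℕ) {x : ℝ} (hx : -1 < x) :
    logMultipleGamma n x = ((logMultipleGamma n x).re : ℂ) :=
  Complex.ext (by simp) (by simp [logMultipleGamma_im n x hx])

/-! ### The plane without the non-positive integers -/

/-- The complement of the non-positive integers. -/
def nonposIntCompl : Set ℂ := {z : ℂ | ∀ m : ℕ, z ≠ -(m : ℂ)}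

theorem nonposIntCompl_eq : nonposIntCompl = (Set.range fun m : ℕ => -(m : ℂ))ᶜ := by
  ext z
  simp [nonposIntCompl, eq_comm]

theorem isOpen_nonposIntCompl : IsOpen nonposIntCompl := by
  rw [nonposIntCompl_eq, isOpen_compl_iff]
  have h := Complex.isClosedEmbedding_intCast.isClosedMap (Set.range fun m : ℕ => -(m : ℤ))
    (isClosed_discrete _)
  convert h
  rw [← Set.range_comp]
  congr 1
  ext m
  simp

theorem isPreconnected_nonposIntCompl : IsPreconnected nonposIntCompl := by
  rw [nonposIntCompl_eq]
  exact ((Set.countable_range _).isConnected_compl_of_one_lt_rank (by simp)).isPreconnected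

theorem slitPlane_subset_nonposIntCompl : Complex.slitPlane ⊆ nonposIntCompl := by
  rintro z hz m rfl
  rcases hz with h | h
  · simp at h; linarith [m.cast_nonneg (α := ℝ)]
  · simp at h

theorem re_pos_subset_nonposIntCompl {z : ℂ} (hz : 0 < z.re) : z ∈ nonposIntCompl :=
  slitPlane_subset_nonposIntCompl (Or.inl hz)

theorem add_natCast_mem_nonposIntCompl {z : ℂ} (hz : z ∈ nonposIntCompl) (n : ℕ) :
    z + n ∈ nonposIntCompl := by
  intro m h
  refine hz (m + n) ?_
  push_cast
  linear_combination h

/-- Continuation to the left along the functional equation `E (z + 1) = g z * E z`. -/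
theorem exists_extension_of_add_one {E g : ℂ → ℂ} (hg : DifferentiableOn ℂ g nonposIntCompl)
    (hg0 : ∀ z ∈ nonposIntCompl, g z ≠ 0) (hE : ∀ z : ℂ, 0 < z.re → DifferentiableAt ℂ E z)
    (hE0 : ∀ z : ℂ, 0 < z.re → E z ≠ 0) (hfe : ∀ z : ℂ, 0 < z.re → E (z + 1) = g z * E z) :
    ∃ G : ℂ → ℂ, DifferentiableOn ℂ G nonposIntCompl ∧ (∀ z ∈ nonposIntCompl, G z ≠ 0) ∧
      ∀ z : ℂ, 0 < z.re → G z = E z := by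
  -- Once z + N is in the right half-plane, the quotient does not depend on N.
  set Q : ℕ → ℂ → ℂ := fun N z => E (z + N) / ∏ i ∈ Finset.range N, g (z + i) with hQ
  have prod_ne : ∀ N : ℕ, ∀ z ∈ nonposIntCompl, ∏ i ∈ Finset.range N, g (z + i) ≠ 0 :=
    fun N z hz => Finset.prod_ne_zero_iff.2 fun i _ => hg0 _ (add_natCast_mem_nonposIntCompl hz i)
  have step : ∀ (N d : ℕ) (z : ℂ), z ∈ nonposIntCompl → 0 < (z + N).re →
      Q (N + d) z = Q N z := by
    intro N d z hz hN
    induction d with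
    | zero => rfl
    | succ d ih =>
      rw [← ih]
      have hpos : 0 < (z + (N + d : ℕ)).re := by
        simp at hN ⊢; linarith [d.cast_nonneg (α := ℝ)]
      simp only [hQ]
      rw [← add_assoc N d 1, Finset.prod_range_succ, Nat.cast_succ, ← add_assoc z, hfe _ hpos,
        mul_comm (g _)]
      exact mul_div_mul_right _ _ (hg0 _ (add_natCast_mem_nonposIntCompl hz _))
  choose n hn using exists_nat_re_add_pos
  have hG : ∀ (N : ℕ) (z : ℂ), z ∈ nonposIntCompl → 0 < (z + N).re → Q (n z) z = Q N z := by
    intro N z hz hN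
    rw [← step N (n z) z hz hN, ← step (n z) N z hz (hn z), add_comm]
  refine ⟨fun z => Q (n z) z, fun z hz => ?_, fun z hz => ?_, fun z hz => ?_⟩
  · have h1 : (fun z => Q (n z) z) =ᶠ[nhds z] Q (n z) := by
      have ho : IsOpen {w : ℂ | 0 < (w + n z).re} :=
        isOpen_lt continuous_const (Complex.continuous_re.comp (continuous_id.add continuous_const))
      filter_upwards [isOpen_nonposIntCompl.mem_nhds hz, ho.mem_nhds (hn z)] with w hw hw1
        using hG _ w hw hw1
    refine (DifferentiableAt.congr_of_eventuallyEq ?_ h1).differentiableWithinAt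
    have hs : ∀ i : ℕ, DifferentiableAt ℂ (fun w : ℂ => w + i) z := fun i => by fun_prop
    refine DifferentiableAt.fun_div (DifferentiableAt.comp (g := E) z (hE _ (hn z)) (hs _))
      (DifferentiableAt.fun_finsetProd fun i _ => ?_) (prod_ne _ z hz)
    exact DifferentiableAt.comp (g := g) z ((hg.differentiableAt (isOpen_nonposIntCompl.mem_nhds
      (add_natCast_mem_nonposIntCompl hz i)))) (hs i)
  · exact div_ne_zero (hE0 _ (hn z)) (prod_ne _ z hz)
  · change Q (n z) z = E z
    rw [hG 0 z (re_pos_subset_nonposIntCompl hz) (by simpa using hz)]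
    simp [hQ]

/-! ### Existence of the hierarchy -/

theorem differentiableAt_exp_logMultipleGamma (n : ℕ) {z : ℂ} (hz : z ∈ Complex.slitPlane) :
    DifferentiableAt ℂ (fun z => Complex.exp (logMultipleGamma n (z - 1))) z := by
  have h1 : DifferentiableAt ℂ (fun z : ℂ => z - 1) z := by fun_prop
  exact (DifferentiableAt.comp (g := logMultipleGamma n) z (analyticAt_logMultipleGamma n
    (by simpa using hz)).differentiableAt h1).cexp

theorem exp_logMultipleGamma_add_one (n : ℕ) {z : ℂ} (hz : z ∈ Complex.slitPlane) :
    Complex.exp (logMultipleGamma (n + 1) (z + 1 - 1)) =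
      Complex.exp (logMultipleGamma n (z - 1)) *
        Complex.exp (logMultipleGamma (n + 1) (z - 1)) := by
  have h := logMultipleGamma_add_one n (z := z - 1) (by simpa using hz)
  rw [show z + 1 - 1 = z - 1 + 1 by ring, h, Complex.exp_add, mul_comm]

theorem exp_logMultipleGamma_zero {z : ℂ} (hz : z ≠ 0) :
    Complex.exp (logMultipleGamma 0 (z - 1)) = z := by
  rw [logMultipleGamma, sub_add_cancel, Complex.exp_log hz]

theorem exists_multipleGamma (n : ℕ) : ∃ G : ℂ → ℂ, (n = 0 → G = id) ∧
    DifferentiableOn ℂ G nonposIntCompl ∧ (∀ z ∈ nonposIntCompl, G z ≠ 0) ∧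
      ∀ z : ℂ, 0 < z.re → G z = Complex.exp (logMultipleGamma n (z - 1)) := by
  induction n with
  | zero =>
    refine ⟨id, fun _ => rfl, differentiable_id.differentiableOn, fun z hz => ?_, fun z hz => ?_⟩
    · simpa using hz 0
    · exact (exp_logMultipleGamma_zero (Complex.slitPlane_ne_zero (Or.inl hz))).symm
  | succ n ih =>
    obtain ⟨g, -, hg, hg0, hgE⟩ := ih
    obtain ⟨G, h1, h2, h3⟩ := exists_extension_of_add_one hg hg0
      (fun z hz => differentiableAt_exp_logMultipleGamma (n + 1) (Or.inl hz))
      (fun z _ => Complex.exp_ne_zero _)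
      (fun z hz => by rw [hgE z hz]; exact exp_logMultipleGamma_add_one n (Or.inl hz))
    exact ⟨G, fun h => absurd h n.succ_ne_zero, h1, h2, h3⟩

theorem exists_isMultipleGammaHierarchy : ∃ G : ℕ → ℂ → ℂ, IsMultipleGammaHierarchy G := by
  choose G hid hd h0 hE using exists_multipleGamma
  have hval : ∀ (n : ℕ) (x : ℝ), -1 < x →
      G n ((x : ℂ) + 1) = ((Real.exp (logMultipleGamma n x).re : ℝ) : ℂ) := by
    intro n x hx
    rw [hE n _ (by simp; linarith), add_sub_cancel_right, Complex.ofReal_exp,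
      ← logMultipleGamma_ofReal n hx]
  refine ⟨G, hd, fun n x hx => ⟨_, Real.exp_pos _, hval n x (by linarith)⟩, fun n z hz => ?_,
    fun n => ?_, fun n x hx => ?_, fun z => by rw [hid 0 rfl]; rfl⟩
  · have hd1 : DifferentiableOn ℂ (fun z => G (n + 1) (z + 1)) nonposIntCompl :=
      (hd (n + 1)).comp (by fun_prop) fun z hz => by
        simpa using add_natCast_mem_nonposIntCompl hz 1
    -- The functional equation is known on the right half-plane and spreads by the identity theorem,
    -- the domain being connected.
    have heq := (hd1.analyticOnNhd isOpen_nonposIntCompl).eqOn_of_preconnected_of_eventuallyEq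
      (((hd n).mul (hd (n + 1))).analyticOnNhd isOpen_nonposIntCompl)
      isPreconnected_nonposIntCompl (re_pos_subset_nonposIntCompl (z := 1) (by simp)) (by
        have ho : IsOpen {w : ℂ | 0 < w.re} := isOpen_lt continuous_const Complex.continuous_re
        filter_upwards [ho.mem_nhds (show (0 : ℝ) < (1 : ℂ).re by simp)] with w hw
        have hw : 0 < w.re := hw
        rw [Pi.mul_apply, hE _ _ (by simp; linarith), hE _ _ hw, hE _ _ hw,
          exp_logMultipleGamma_add_one n (Or.inl hw)])
    exact heq hz
  · rw [hE n 1 (by simp), sub_self, logMultipleGamma_zero_right, Complex.exp_zero]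
  · have h1 : (fun t : ℝ => Real.log (G n ((t : ℂ) + 1)).re) =ᶠ[nhds x]
        fun t : ℝ => (logMultipleGamma n t).re := by
      filter_upwards [lt_mem_nhds (show -1 < x by linarith)] with t ht
      rw [hval n t ht, Complex.ofReal_re, Real.log_exp]
    rw [h1.iteratedDeriv_eq, iteratedDeriv_re_comp_ofReal _
      (analyticAt_logMultipleGamma n (ofReal_add_one_mem_slitPlane (by linarith)))]
    have h2 := iteratedDeriv_logMultipleGamma_sign n (n + 1) (by omega) x (by linarith)
    rwa [show n + 1 + n + 1 = 2 * (n + 1) by ring, pow_mul, neg_one_sq, one_pow, one_mul] at h2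

/-! ### Uniqueness of the hierarchy -/

theorem isPreconnected_slitPlane : IsPreconnected Complex.slitPlane :=
  (Complex.starConvex_one_slitPlane.isPathConnected (by simp)).isConnected.isPreconnected

theorem IsMultipleGammaHierarchy.exp_re {G : ℕ → ℂ → ℂ} (hG : IsMultipleGammaHierarchy G) (n : ℕ)
    {x : ℝ} (hx : 0 ≤ x) : 0 < (G n ((x : ℂ) + 1)).re ∧
      G n ((x : ℂ) + 1) = ((G n ((x : ℂ) + 1)).re : ℂ) := by
  obtain ⟨r, hr, h⟩ := hG.pos n x hx
  rw [h]
  exact ⟨by simpa using hr, by simp⟩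

/-- The sign condition bounds the derivative of log G_{n+1} - L_{n+1} of order n + 2 below by minus
that of L_{n+1}, which tends to 0. The periodicity lemma gives equality on the positive axis, and
analyticity extends it. -/
theorem IsMultipleGammaHierarchy.eq_exp {G : ℕ → ℂ → ℂ} (hG : IsMultipleGammaHierarchy G) (n : ℕ) :
    ∀ z ∈ Complex.slitPlane, G n z = Complex.exp (logMultipleGamma n (z - 1)) := by
  induction n with
  | zero =>
    intro z hz
    rw [hG.zero, exp_logMultipleGamma_zero (Complex.slitPlane_ne_zero hz)]
  | succ n ih =>
    -- The principal logarithm suffices: it is used only near positive reals, where G_{n+1}(x+1) >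
    -- 0.
    set f : ℂ → ℂ := fun z => Complex.log (G (n + 1) (z + 1)) with hf
    have hGd : ∀ x : ℝ, 0 < x → AnalyticAt ℂ (fun z => G (n + 1) (z + 1)) x := by
      intro x hx
      have h1 : AnalyticAt ℂ (G (n + 1)) ((x : ℂ) + 1) :=
        (hG.differentiableOn (n + 1)).analyticAt (isOpen_nonposIntCompl.mem_nhds
          (re_pos_subset_nonposIntCompl (by simp; linarith)))
      exact h1.comp_of_eq (g := G (n + 1)) (analyticAt_id.add analyticAt_const) rfl
    have hfa : ∀ x : ℝ, 0 < x → AnalyticAt ℂ f x := fun x hx =>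
      (hGd x hx).clog (Or.inl (hG.exp_re (n + 1) hx.le).1)
    have hFa : ∀ x : ℝ, 0 < x → AnalyticAt ℂ (logMultipleGamma (n + 1)) x := fun x hx =>
      analyticAt_logMultipleGamma (n + 1) (ofReal_add_one_mem_slitPlane (by linarith))
    have hfre : ∀ x : ℝ, (f x).re = Real.log ‖G (n + 1) ((x : ℂ) + 1)‖ := fun x =>
      Complex.log_re _
    have hnorm : ∀ x : ℝ, 0 ≤ x → ‖G (n + 1) ((x : ℂ) + 1)‖ = (G (n + 1) ((x : ℂ) + 1)).re := by
      intro x hx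
      rw [(hG.exp_re (n + 1) hx).2, Complex.norm_real, Complex.ofReal_re,
        Real.norm_of_nonneg (hG.exp_re (n + 1) hx).1.le]
    have hfe : ∀ x : ℝ, 0 ≤ x → (f ((x + 1 : ℝ) : ℂ)).re = (f x).re + (logMultipleGamma n x).re := by
      intro x hx
      have hmem : (x : ℂ) + 1 ∈ Complex.slitPlane := ofReal_add_one_mem_slitPlane (by linarith)
      rw [hfre, hfre]
      push_cast
      rw [hG.add_one n _ (slitPlane_subset_nonposIntCompl hmem), ih _ hmem,
        add_sub_cancel_right, norm_mul, Complex.norm_exp,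
        Real.log_mul (Real.exp_ne_zero _) (by
          rw [hnorm x hx]; exact (hG.exp_re (n + 1) hx).1.ne'), Real.log_exp, add_comm]
    have hf1 : (f 1).re = 0 := by
      have h := hfe 0 le_rfl
      rw [hfre 0] at h
      simpa [hG.one, logMultipleGamma_zero_right] using h
    have hF1 : logMultipleGamma (n + 1) 1 = 0 := by
      have h := logMultipleGamma_add_one n (z := 0) (by simp)
      simpa [logMultipleGamma_zero_right] using h
    have hmain := eq_zero_of_periodic_of_le_deriv
      (u := fun i x => (iteratedDeriv i f x).re - (iteratedDeriv i (logMultipleGamma (n + 1)) x).re)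
      (a := 0)
      (fun i x hx => ((hfa x hx).hasDerivAt_iteratedDeriv i).real_of_complex.sub
        ((hFa x hx).hasDerivAt_iteratedDeriv i).real_of_complex)
      (fun x hx => by
        simp only [iteratedDeriv_zero]
        rw [hfe x hx.le]
        push_cast
        rw [logMultipleGamma_add_one n (ofReal_add_one_mem_slitPlane (by linarith)),
          Complex.add_re]
        ring)
      (v := fun x => -(iteratedDeriv (n + 2) (logMultipleGamma (n + 1)) x).re) (n := n + 1) (by
        have h1 := (Complex.continuous_re.tendsto 0).comp
          (tendsto_iteratedDeriv_logMultipleGamma (n + 1) (n + 2) (by omega))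
        simpa [Function.comp_def] using h1.neg)
      (fun x hx => by
        have h1 := hG.iteratedDeriv_nonneg (n + 1) x hx.le
        have h2 : (fun t : ℝ => Real.log (G (n + 1) ((t : ℂ) + 1)).re) =ᶠ[nhds x]
            fun t : ℝ => (f t).re := by
          filter_upwards [lt_mem_nhds hx] with t ht
          rw [hfre, hnorm t ht.le]
        rw [h2.iteratedDeriv_eq, iteratedDeriv_re_comp_ofReal _ (hfa x hx)] at h1
        linarith) (p := 1) one_pos (by simp [hf1, hF1])
    have hreal : ∀ x : ℝ, 0 < x →
        G (n + 1) ((x : ℂ) + 1) = Complex.exp (logMultipleGamma (n + 1) x) := by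
      intro x hx
      have h1 := hmain x hx
      simp only [iteratedDeriv_zero] at h1
      rw [hfre, hnorm x hx.le, sub_eq_zero] at h1
      rw [(hG.exp_re (n + 1) hx.le).2, logMultipleGamma_ofReal (n + 1) (by linarith), ← h1,
        ← Complex.ofReal_exp, Real.exp_log (hG.exp_re (n + 1) hx.le).1]
    have hd1 : DifferentiableOn ℂ (G (n + 1)) Complex.slitPlane :=
      (hG.differentiableOn (n + 1)).mono slitPlane_subset_nonposIntCompl
    have hd2 : DifferentiableOn ℂ (fun z => Complex.exp (logMultipleGamma (n + 1) (z - 1)))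
        Complex.slitPlane := fun z hz =>
      (differentiableAt_exp_logMultipleGamma (n + 1) hz).differentiableWithinAt
    refine (hd1.analyticOnNhd Complex.isOpen_slitPlane).eqOn_of_preconnected_of_frequently_eq
      (hd2.analyticOnNhd Complex.isOpen_slitPlane) isPreconnected_slitPlane
      (z₀ := 2) (Or.inl (by simp)) ?_
    have hseq : Filter.Tendsto (fun x : ℝ => (x : ℂ)) (nhdsWithin 2 {2}ᶜ)
        (nhdsWithin (2 : ℂ) {2}ᶜ) := by
      refine tendsto_nhdsWithin_iff.2 ⟨?_, ?_⟩
      · have h := (Complex.continuous_ofReal.tendsto 2).mono_left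
          (nhdsWithin_le_nhds (s := {2}ᶜ))
        rwa [Complex.ofReal_ofNat] at h
      · filter_upwards [self_mem_nhdsWithin] with x hx h
        have h : (x : ℂ) = 2 := h
        exact hx (show x = 2 by exact_mod_cast h)
    refine hseq.frequently (Filter.Eventually.frequently ?_)
    filter_upwards [nhdsWithin_le_nhds (lt_mem_nhds (show (1 : ℝ) < 2 by norm_num))] with x hx
    have := hreal (x - 1) (by linarith)
    push_cast at this
    simpa using this

/-! ### The branch of the logarithm -/

theorem isPreconnected_slitPlane_sub_one : IsPreconnected {z : ℂ | z + 1 ∈ Complex.slitPlane} := by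
  have : {z : ℂ | z + 1 ∈ Complex.slitPlane} = (fun z => z - 1) '' Complex.slitPlane := by
    ext z
    constructor
    · intro h; exact ⟨z + 1, h, by simp⟩
    · rintro ⟨w, hw, rfl⟩; simpa using hw
  rw [this]
  exact isPreconnected_slitPlane.image _ (by fun_prop)

/-- The difference of two branches has exponential 1, hence zero derivative on a connected domain.
-/
theorem IsLogBranch.unique {g L₁ L₂ : ℂ → ℂ} (h₁ : IsLogBranch g L₁) (h₂ : IsLogBranch g L₂)
    {z : ℂ} (hz : z + 1 ∈ Complex.slitPlane) : L₁ z = L₂ z := by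
  set D : Set ℂ := {z : ℂ | z + 1 ∈ Complex.slitPlane} with hD
  have hd : DifferentiableOn ℂ (fun z => L₁ z - L₂ z) D :=
    h₁.differentiableOn.sub h₂.differentiableOn
  have hexp : ∀ w ∈ D, Complex.exp (L₁ w - L₂ w) = 1 := by
    intro w hw
    rw [Complex.exp_sub, h₁.exp_eq w hw, h₂.exp_eq w hw, div_self]
    rw [← h₁.exp_eq w hw]
    exact Complex.exp_ne_zero _
  have hderiv : Set.EqOn (deriv fun z => L₁ z - L₂ z) 0 D := by
    intro w hw
    have hw' := isOpen_slitPlane_sub_one.mem_nhds hw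
    have h1 := (hd.differentiableAt hw').hasDerivAt.cexp
    have h2 : (fun z => Complex.exp (L₁ z - L₂ z)) =ᶠ[nhds w] fun _ => 1 := by
      filter_upwards [hw'] with v hv using hexp v hv
    have h3 := h1.unique ((hasDerivAt_const w (1 : ℂ)).congr_of_eventuallyEq h2)
    rwa [hexp w hw, one_mul] at h3
  have := isOpen_slitPlane_sub_one.is_const_of_deriv_eq_zero isPreconnected_slitPlane_sub_one hd
    hderiv hz (show (0 : ℂ) ∈ D by simp [hD])
  rw [h₁.zero, h₂.zero, sub_self] at this
  exact sub_eq_zero.1 this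

theorem IsMultipleGammaHierarchy.isLogBranch {G : ℕ → ℂ → ℂ} (hG : IsMultipleGammaHierarchy G)
    (n : ℕ) : IsLogBranch (G n) (logMultipleGamma n) where
  differentiableOn := differentiableOn_logMultipleGamma n
  exp_eq z hz := by rw [hG.eq_exp n _ hz, add_sub_cancel_right]
  zero := logMultipleGamma_zero_right n

theorem proposition5p2 :
    (∀ (j : ℕ) (z : ℂ), z + 1 ∈ Complex.slitPlane →
      Summable fun k : ℕ => ‖kTerm j z (k + 1)‖) ∧
    (∃ G : ℕ → ℂ → ℂ, IsMultipleGammaHierarchy G) ∧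
    ∀ G : ℕ → ℂ → ℂ, IsMultipleGammaHierarchy G → ∀ n : ℕ, 1 ≤ n →
      (∃ L : ℂ → ℂ, IsLogBranch (G n) L) ∧
      ∀ L : ℂ → ℂ, IsLogBranch (G n) L → ∀ z : ℂ, z + 1 ∈ Complex.slitPlane →
        L z = ∑ j ∈ Finset.range n, binomCoeffPoly n j z * funK j z := by
  refine ⟨fun j z _ => summable_norm_kTerm j z, exists_isMultipleGammaHierarchy,
    fun G hG n hn => ⟨⟨_, hG.isLogBranch n⟩, fun L hL z hz => ?_⟩⟩
  rw [hL.unique (hG.isLogBranch n) hz]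
  obtain ⟨n, rfl⟩ := Nat.exists_eq_add_of_le' hn
  rfl
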